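/- **Model.** Macro base stations (MBSs) $\Phi_m$, small-cell base stations (SBSs) $\Phi_s$ and users $\Phi_u$ are independent homogeneous Poisson point processes on $\mathbb{R}^2$ with densities $\lambda_m,\lambda_s,\lambda_u>0$; a typical uplink (UL) user sits at the origin. A link of length $d$ between two devices is line of sight ($l$) with probability $p_l(d)=p_{\mathrm{LOS}}\mathbb{1}(d\le d_{\mathrm{LOS}})$ and otherwise not ($n$), independently over links; its path loss is $L=d^{\alpha_\mu}$, $\mu\in\{l,n\}$, $\alpha_\mu>0$. In slot $i$ device $Y$ (of kind $m$, $s$ or $u$, with transmit power $P_m,P_s,P_u>0$, main-lobe gain $G_\cdot>0$, side-lobe gain $g_\cdot\ge 0$ and beamwidth $\Delta_\cdot\in[0,2\pi]$) is received at $X$ with power $C_0P_Yh_{i,X,Y}G_{i,X,Y}L(X,Y)^{-1}$, where the fading variables $h_{i,X,Y}$ are i.i.d. exponential of mean $1$ over ordered pairs. On interfering links the gains $G_{i,X,Y}$ are independent products of a receiver gain and a transmitter gain, each equal to the main-lobe gain $G_k$ with probability $\Delta_k/2\pi$ and to $g_k$ otherwise, $k$ being the kind of the device; on the desired link the gain is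 $G_uG_t$. A user associates with the BS, of tier $t\in\{m,s\}$, that maximizes $P_tL^{-1}G_tB_t$ (with biases $B_t>0$), and an SBS with the MBS of least path loss. $X^*$ is the BS serving the origin, $X^{**}$ is the MBS serving $X^*$ when $X^*\in\Phi_s$, $\Phi_{t,\mu}$ is the set of BSs of tier $t$ whose link to the origin has state $\mu$, and $\mathcal{A}_t=\mathbb{P}(X^*\in\Phi_t)$. **Frames.** A frame has $F$ slots. For $x\ge 0$, rounding $x$ at random means taking $\lceil x\rceil$ with probability $x-\lfloor x\rfloor$ and $\lfloor x\rfloor$ otherwise. With $\delta,\eta,\gamma_a\in[0,1]$ fixed, $F_a$ (access slots) is $\delta F$ and $F_{bd}$ (downlink (DL) backhaul slots) is $\eta(F-F_a)$, both rounded at random and common to all BSs. The number $F_{ad,Y}$ of DL access slots of a BS $Y$ is under static TDD ($w=S$) the randomly rounded $\gamma_aF_a$, common to all BSs, and under dynamic TDD ($w=D$) the randomly and independently rounded $F_aN_{d,Y}/(N_{u,Y}+N_{d,Y})$ ($0$ if $N_{d,Y}=0$). The loads $(N_{u,Y},N_{d,Y})$ are independent marks of the BSs with $$\mathbb{P}(N_{u,Y}=n_1,N_{d,Y}=n_2)=\frac{3.5^{3.5}}{\Gamma(3.5)}\,\frac{\eta^{n_2}(1-\eta)^{n_1}}{n_1!\,n_2!}\,\frac{\Gamma(n_1+n_2+3.5)}{\epsilon^{3.5}(1+3.5/\epsilon)^{n_1+n_2+3.5}},\qquad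 \epsilon=\lambda_u\mathcal{A}_t/\lambda_t,\quad Y\in\Phi_t.$$ Let $\mathcal{F}$ consist of $F_a$, $F_{bd}$ and, under static TDD, the common $F_{ad}$. Each user independently has DL traffic with probability $\eta$ and UL traffic otherwise. All random elements not said to depend on each other are independent (within a slot; dependence across slots is arbitrary). **Interference** at $X^*$ in slot $i$ is $I=I_m+I_s+I_u$, each term being a sum of received powers over the following transmitters. * $i\le F_a$: for $\nu\in\{m,s\}$, $I_\nu$ is over $Y\in\Phi_\nu\setminus\{X^*\}$ with $i\le F_{ad,Y}$ and $N_{d,Y}>0$; $I_u$ is over the scheduled users of all BSs $Y\ne X^*$ with $F_{ad,Y}<i$ and $N_{u,Y}>0$. The scheduled user of $Y$ is uniform among the UL users of $\Phi_u$ associated with $Y$; there is no such interferer if there is none. * $i>F_a$: slots $F_a<i\le F_a+F_{bd}$ are DL and slots $F_a+F_{bd}<i\le F$ are UL. In a slot of a given direction, each MBS schedules for backhaul one SBS, uniform among the SBSs other than $X^*$ that are connected to it and have $N_{d}>0$ (DL) or $N_u>0$ (UL), if there is any. In DL slots $I_m$ is over the MBSs $\neq X^{**}$ that schedule an SBS;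 in UL slots $I_s$ contains the scheduled SBSs. Under unsynchronized access-backhaul (UAB), each SBS $Y\ne X^*$ not scheduled for backhaul poaches, independently, with probability $p_{dl}$ in DL slots and $p_{ul}$ in UL slots: in DL slots those with $N_{d,Y}>0$ are added to $I_s$, and in UL slots the scheduled users of those with $N_{u,Y}>0$ form $I_u$. Nothing else interferes. With $X^*\in\Phi_t$ and noise power $\sigma^2\ge 0$, $C_0>0$, $$\mathsf{SINR}_i=\frac{C_0P_uh_{i,X^*,0}G_uG_tL(X^*,0)^{-1}}{I+\sigma^2}.$$ Let $L^{t,\mu}_{i}(\mathsf s,R)=\mathbb{E}[e^{-\mathsf sI}\mid X^*\in\Phi_{t,\mu},\|X^*\|=R,\mathcal{F}]$ be the exact conditional Laplace transform of the interference. **Theorem.** Let $1\le i\le F$ and $\tau>0$. For $t\in\{m,s\}$ put $$\mathsf S^{t}_i(\tau)=\sum_{\mu\in\{l,n\}}\int_0^\infty \exp\Big(\frac{-\tau R^{\alpha_\mu}\sigma^2}{C_0P_uG_uG_t}\Big)L^{t,\mu}_i\Big(\frac{\tau R^{\alpha_\mu}}{C_0P_uG_uG_t},R\Big)\prod_{(t',\mu')\ne(t,\mu)}F_{t',\mu'}\Big(\Big(\frac{P_{t'}G_{t'}B_{t'}R^{\alpha_\mu}}{P_tB_tG_t}\Big)^{1/\alpha_{\mu'}}\Big)\frac{f_{t,\mu}(R)}{\mathcal{A}_t}\,dR,$$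 a function of $\mathcal{F}$, where $$F_{t,l}(R)=e^{-\pi\lambda_tp_{\mathrm{LOS}}\min(R,d_{\mathrm{LOS}})^2},\qquad F_{t,n}(R)=e^{-\pi\lambda_t(R^2-p_{\mathrm{LOS}}\min(R,d_{\mathrm{LOS}})^2)},$$ $$f_{t,l}(R)=2\pi\lambda_tRp_{\mathrm{LOS}}\mathbb{1}(R\le d_{\mathrm{LOS}})F_{t,l}(R),\qquad f_{t,n}(R)=2\pi\lambda_tR\,(1-p_{\mathrm{LOS}}\mathbb{1}(R\le d_{\mathrm{LOS}}))F_{t,n}(R).$$ 1. (Access slots, static or dynamic TDD.) For each value of $\mathcal{F}$ of positive probability with $i\le F_a$, $\mathbb{P}(\mathsf{SINR}_i>\tau\mid X^*\in\Phi_t,\mathcal{F})=\mathsf S^t_i(\tau)$ for both $t$, and $$\mathsf S_i(\tau):=\mathbb{P}(\mathsf{SINR}_i>\tau\mid\mathcal{F})=\mathcal{A}_m\mathsf S^m_i(\tau)+\mathcal{A}_s\mathsf S^s_i(\tau).$$ The SINR coverage is its mean over $\mathcal{F}$: $\mathbb{P}(\mathsf{SINR}_i>\tau\mid i\le F_a)=\mathbb{E}[\mathsf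 S_i(\tau)\mid i\le F_a]$ whenever $\mathbb{P}(i\le F_a)>0$. 2. (Backhaul slots under UAB.) For each value of $\mathcal{F}$ of positive probability with $i>F_a$, $\mathbb{P}(\mathsf{SINR}_i>\tau\mid X^*\in\Phi_s,\mathcal{F})=\mathsf S^s_i(\tau)$, and $\mathbb{P}(\mathsf{SINR}_i>\tau\mid X^*\in\Phi_s,i>F_a)=\mathbb{E}[\mathsf S^s_i(\tau)\mid i>F_a]$ whenever $\mathbb{P}(i>F_a)>0$. -/

import Mathlib

open MeasureTheory ProbabilityTheory Set
open scoped ENNReal NNReal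

noncomputable section

namespace MmWave

/-- The plane, with its Euclidean norm. -/
abbrev Plane := EuclideanSpace ℝ (Fin 2)

/-- The two tiers of base stations: macro (`m`) and small cell (`s`). -/
inductive Tier | m | s
  deriving DecidableEq

/-- State of a link: line of sight (`l`) or not (`n`). -/
inductive Los | l | n
  deriving DecidableEq

/-- The kinds of devices: macro BS, small cell BS, user. -/
inductive Kind | m | s | u
  deriving DecidableEq

/-- Traffic direction. -/
inductive Dir | ul | dl
  deriving DecidableEq

/-- Static or dynamic TDD in the access subframe. -/
inductive AccessScheme | static | dynamic
  deriving DecidableEq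

/-- Synchronized or unsynchronized access-backhaul. -/
inductive BackhaulScheme | SAB | UAB
  deriving DecidableEq

def Tier.kind : Tier → Kind
  | .m => .m
  | .s => .s

instance : Fintype Tier := ⟨{.m, .s}, by rintro (_ | _) <;> simp⟩

instance : Fintype Los := ⟨{.l, .n}, by rintro (_ | _) <;> simp⟩

instance : Encodable Tier :=
  Encodable.ofLeftInverse (fun t => match t with | .m => false | .s => true)
    (fun b => if b then .s else .m) (by rintro (_ | _) <;> rfl)

/-- A base station: its tier and its number in an enumeration of that tier. -/
abbrev BS := Tier × ℕ

/-- Devices: base stations, users of the user process, and the typical user at the origin. -/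
inductive Device
  | bs (b : BS)
  | ue (k : ℕ)
  | typ

def Device.kind : Device → Kind
  | .bs b => b.1.kind
  | .ue _ => .u
  | .typ => .u

/-- System parameters (linear scale, angles in radians). -/
structure Params where
  /-- densities of the MBS, SBS and user processes -/
  lam : Kind → ℝ
  /-- fraction of users with downlink requests; also the downlink share of backhaul slots -/
  eta : ℝ
  /-- downlink share of access slots under static TDD -/
  gammaA : ℝ
  /-- transmit powers -/
  pow : Kind → ℝ
  /-- half power beamwidths -/
  beam : Kind → ℝ
  /-- main lobe gains -/
  mainGain : Kind → ℝ
  /-- side lobe gains -/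
  sideGain : Kind → ℝ
  /-- association biases -/
  bias : Tier → ℝ
  pLos : ℝ
  dLos : ℝ
  /-- path loss exponents -/
  alpha : Los → ℝ
  /-- reference path loss at unit distance -/
  C0 : ℝ
  /-- thermal noise power -/
  noise : ℝ
  /-- number of slots of a frame -/
  F : ℕ
  /-- fraction of access slots -/
  delta : ℝ
  /-- poaching probabilities -/
  pUl : ℝ
  pDl : ℝ
  lam_pos : ∀ k, 0 < lam k
  eta_mem : eta ∈ Icc (0 : ℝ) 1
  gammaA_mem : gammaA ∈ Icc (0 : ℝ) 1
  pow_pos : ∀ k, 0 < pow k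
  beam_mem : ∀ k, beam k ∈ Icc 0 (2 * Real.pi)
  mainGain_pos : ∀ k, 0 < mainGain k
  sideGain_nonneg : ∀ k, 0 ≤ sideGain k
  bias_pos : ∀ t, 0 < bias t
  pLos_mem : pLos ∈ Icc (0 : ℝ) 1
  dLos_nonneg : 0 ≤ dLos
  alpha_pos : ∀ a, 0 < alpha a
  C0_pos : 0 < C0
  noise_nonneg : 0 ≤ noise
  delta_mem : delta ∈ Icc (0 : ℝ) 1
  pUl_mem : pUl ∈ Icc (0 : ℝ) 1
  pDl_mem : pDl ∈ Icc (0 : ℝ) 1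

/-- Probability that a link of length `d` is line of sight (generalized LOS ball). -/
def Params.losProb (p : Params) (d : ℝ) : ℝ := if d ≤ p.dLos then p.pLos else 0

/-- Joint probability mass function of the numbers of uplink (`n₁`) and downlink (`n₂`) users of a
typical base station whose mean number of users is `ε`. -/
def Params.loadPMF (p : Params) (ε : ℝ) (n₁ n₂ : ℕ) : ℝ :=
  (3.5 : ℝ) ^ (3.5 : ℝ) / Real.Gamma 3.5
    * (p.eta ^ n₂ * (1 - p.eta) ^ n₁ / (n₁.factorial * n₂.factorial))
    * (Real.Gamma ((n₁ : ℝ) + n₂ + 3.5)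
        / (ε ^ (3.5 : ℝ) * (1 + 3.5 / ε) ^ ((n₁ : ℝ) + n₂ + 3.5)))

/-- Law of the antenna gain product of an interfering link between devices of kinds `a`, `b`. -/
def Params.gainLaw (p : Params) (a b : Kind) : Measure ℝ :=
  ENNReal.ofReal (p.beam a * p.beam b / (4 * Real.pi ^ 2))
      • Measure.dirac (p.mainGain a * p.mainGain b)
    + ENNReal.ofReal (p.beam a * (2 * Real.pi - p.beam b) / (4 * Real.pi ^ 2))
      • Measure.dirac (p.mainGain a * p.sideGain b)
    + ENNReal.ofReal ((2 * Real.pi - p.beam a) * p.beam b / (4 * Real.pi ^ 2))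
      • Measure.dirac (p.sideGain a * p.mainGain b)
    + ENNReal.ofReal ((2 * Real.pi - p.beam a) * (2 * Real.pi - p.beam b) / (4 * Real.pi ^ 2))
      • Measure.dirac (p.sideGain a * p.sideGain b)

/-- Uniform law on the unit interval. -/
def unif : Measure ℝ := volume.restrict (Icc 0 1)

/-- The integer `⌈x⌉` if `u` is below the fractional part of `x`, and `⌊x⌋` otherwise; for uniform
`u` this rounds `x ≥ 0` up with probability its fractional part. -/
def randRound (x u : ℝ) : ℕ := if u < Int.fract x then ⌈x⌉₊ else ⌊x⌋₊

/-- An element of the nonempty finite set `S` of naturals, uniform if `v` is uniform on `[0,1]`. -/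
def pick (S : Set ℕ) (v : ℝ) : ℕ := Nat.nth (· ∈ S) ⌊v * S.ncard⌋₊

/-- `X 0, X 1, …` enumerates a homogeneous Poisson point process of intensity `lam` on the plane:
the numbers of points in bounded Borel sets are Poisson, and independent for disjoint sets. -/
structure IsPoissonProcess {Ω : Type*} [MeasurableSpace Ω] (lam : ℝ) (X : ℕ → Ω → Plane)
    (P : Measure Ω) : Prop where
  measurable : ∀ k, Measurable (X k)
  poisson : ∀ A : Set Plane, MeasurableSet A → Bornology.IsBounded A → ∀ n : ℕ,
    P {ω | {k | X k ω ∈ A}.encard = n}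
      = poissonMeasure (lam * (volume A).toReal).toNNReal {n}
  indep : ∀ (n : ℕ) (A : Fin n → Set Plane), (∀ j, MeasurableSet (A j)) →
    Pairwise (fun i j => Disjoint (A i) (A j)) →
    iIndepFun (fun (j : Fin n) ω => {k | X k ω ∈ A j}.encard) P

/-- The random elements of the network. The first argument `ℕ` of `fading`, `gain`, `pickUser`,
`pickSbs` and `poach` is the slot. -/
structure Network (Ω : Type*) where
  /-- enumerations of the MBS, SBS and user processes -/
  point : Kind → ℕ → Ω → Plane
  /-- uniform variables that decide which links are line of sight -/
  blockage : Sym2 Device → Ω → ℝ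
  /-- small scale fading, receiver first -/
  fading : ℕ → Device → Device → Ω → ℝ
  /-- antenna gain products of interfering links, receiver first -/
  gain : ℕ → Device → Device → Ω → ℝ
  /-- numbers of uplink and downlink users of a base station -/
  load : BS → Ω → ℕ × ℕ
  /-- uniform variables that decide which users have downlink requests -/
  direction : ℕ → Ω → ℝ
  /-- uniform variables for the choice of the scheduled uplink user of a base station -/
  pickUser : ℕ → BS → Ω → ℝ
  /-- uniform variables for the choice of the scheduled SBS of an MBS -/
  pickSbs : ℕ → ℕ → Ω → ℝ
  /-- uniform variables for the decision of an SBS to poach -/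
  poach : ℕ → ℕ → Ω → ℝ
  /-- uniform variables for the rounding of the access subframes under dynamic TDD -/
  adCoin : BS → Ω → ℝ
  /-- uniform variables for the rounding of the subframe lengths common to all base stations -/
  frameCoin : Fin 3 → Ω → ℝ

/-- Index set of the independent sources of randomness that enter a given slot. -/
inductive Source
  | point (k : Kind)
  | blockage (e : Sym2 Device)
  | fading (x y : Device)
  | gain (x y : Device)
  | load (b : BS)
  | direction (k : ℕ)
  | pickUser (b : BS)
  | pickSbs (j : ℕ)
  | poach (k : ℕ)
  | adCoin (b : BS)
  | frameCoin (c : Fin 3)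

/-- Where a source takes its values. -/
abbrev Source.Val : Source → Type
  | .point _ => ℕ → Plane
  | .load _ => ℕ × ℕ
  | .blockage _ | .fading _ _ | .gain _ _ | .direction _ | .pickUser _ | .pickSbs _ | .poach _
  | .adCoin _ | .frameCoin _ => ℝ

instance (s : Source) : MeasurableSpace s.Val :=
  match s with
  | .point _ => inferInstanceAs (MeasurableSpace (ℕ → Plane))
  | .load _ => inferInstanceAs (MeasurableSpace (ℕ × ℕ))
  | .blockage _ | .fading _ _ | .gain _ _ | .direction _ | .pickUser _ | .pickSbs _ | .poach _
  | .adCoin _ | .frameCoin _ => inferInstanceAs (MeasurableSpace ℝ)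

namespace Network

variable {Ω : Type*}

/-- The sources of randomness in slot `i`. -/
def source (N : Network Ω) (i : ℕ) : (s : Source) → Ω → s.Val
  | .point k => fun ω j => N.point k j ω
  | .blockage e => N.blockage e
  | .fading x y => N.fading i x y
  | .gain x y => N.gain i x y
  | .load b => N.load b
  | .direction k => N.direction k
  | .pickUser b => N.pickUser i b
  | .pickSbs j => N.pickSbs i j
  | .poach k => N.poach i k
  | .adCoin b => N.adCoin b
  | .frameCoin c => N.frameCoin c

/-! ### Geometry, path loss and association -/

/-- Position of a device; the typical user sits at the origin. -/
def pos (N : Network Ω) : Device → Ω → Plane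
  | .bs b, ω => N.point b.1.kind b.2 ω
  | .ue k, ω => N.point .u k ω
  | .typ, _ => 0

open Classical in
/-- State of the link between two devices. -/
def los (N : Network Ω) (p : Params) (x y : Device) (ω : Ω) : Los :=
  if N.blockage s(x, y) ω < p.losProb (dist (N.pos x ω) (N.pos y ω)) then .l else .n

/-- Path loss between two devices. -/
def pathLoss (N : Network Ω) (p : Params) (x y : Device) (ω : Ω) : ℝ :=
  dist (N.pos x ω) (N.pos y ω) ^ p.alpha (N.los p x y ω)

/-- Biased received power that decides the association of the user `z`. -/
def biasedPower (N : Network Ω) (p : Params) (b : BS) (z : Device) (ω : Ω) : ℝ :=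
  p.pow b.1.kind * (N.pathLoss p (.bs b) z ω)⁻¹ * p.mainGain b.1.kind * p.bias b.1

open Classical in
/-- The base station that serves the user `z`: the maximizer of the biased received power (almost
surely it exists and is unique; of several ones the first is taken). -/
def server (N : Network Ω) (p : Params) (z : Device) (ω : Ω) : BS :=
  if h : ∃ b : BS, ∀ b' : BS, N.biasedPower p b' z ω ≤ N.biasedPower p b z ω
  then Encodable.choose h else (.m, 0)

open Classical in
/-- The MBS that serves the SBS number `k`: the one of least path loss. -/
def sbsServer (N : Network Ω) (p : Params) (k : ℕ) (ω : Ω) : ℕ :=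
  if h : ∃ j : ℕ, ∀ j' : ℕ, N.pathLoss p (.bs (.m, j)) (.bs (.s, k)) ω
      ≤ N.pathLoss p (.bs (.m, j')) (.bs (.s, k)) ω
  then Encodable.choose h else 0

/-- The base station `X*` that serves the typical user. -/
def tagged (N : Network Ω) (p : Params) (ω : Ω) : BS := N.server p .typ ω

/-- The distance `‖X*‖`. -/
def tagDist (N : Network Ω) (p : Params) (ω : Ω) : ℝ := ‖N.pos (.bs (N.tagged p ω)) ω‖

/-- The state of the link from the typical user to `X*`. -/
def tagLos (N : Network Ω) (p : Params) (ω : Ω) : Los := N.los p (.bs (N.tagged p ω)) .typ ω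

/-- The event `X* ∈ Φ_t`. -/
def tierEvent (N : Network Ω) (p : Params) (t : Tier) : Set Ω := {ω | (N.tagged p ω).1 = t}

/-- The event `X* ∈ Φ_{t,μ}`. -/
def typeEvent (N : Network Ω) (p : Params) (t : Tier) (a : Los) : Set Ω :=
  {ω | (N.tagged p ω).1 = t ∧ N.tagLos p ω = a}

/-- Association probability `𝒜_t` of the typical user with tier `t`. -/
def assocProb [MeasurableSpace Ω] (N : Network Ω) (p : Params) (P : Measure Ω) (t : Tier) : ℝ :=
  P.real (N.tierEvent p t)

/-! ### Frame structure -/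

/-- Number of access slots. -/
def Fa (N : Network Ω) (p : Params) (ω : Ω) : ℕ := randRound (p.delta * p.F) (N.frameCoin 0 ω)

/-- Number of downlink backhaul slots. -/
def Fbd (N : Network Ω) (p : Params) (ω : Ω) : ℕ :=
  randRound (p.eta * (p.F - N.Fa p ω : ℕ)) (N.frameCoin 1 ω)

/-- Downlink share of the access slots of a base station under dynamic TDD. -/
def dynShare (N : Network Ω) (b : BS) (ω : Ω) : ℝ :=
  if 0 < (N.load b ω).2 then ((N.load b ω).2 : ℝ) / ((N.load b ω).1 + (N.load b ω).2) else 0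

/-- Number of downlink access slots of all base stations under static TDD. -/
def FadStatic (N : Network Ω) (p : Params) (ω : Ω) : ℕ :=
  randRound (p.gammaA * N.Fa p ω) (N.frameCoin 2 ω)

/-- Number of downlink access slots of the base station `b`. -/
def Fad (N : Network Ω) (p : Params) (wa : AccessScheme) (b : BS) (ω : Ω) : ℕ :=
  match wa with
  | .static => N.FadStatic p ω
  | .dynamic => randRound (N.dynShare b ω * N.Fa p ω) (N.adCoin b ω)

/-- The set of subframe lengths common to all base stations: the access slots, the downlink backhaul
slots and, under static TDD, the downlink access slots. -/
def frame (N : Network Ω) (p : Params) (wa : AccessScheme) (ω : Ω) : ℕ × ℕ × ℕ :=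
  (N.Fa p ω, N.Fbd p ω, match wa with | .static => N.FadStatic p ω | .dynamic => 0)

/-! ### Scheduling -/

/-- Number of uplink or downlink users of a base station. -/
def users (N : Network Ω) (d : Dir) (b : BS) (ω : Ω) : ℕ :=
  match d with
  | .ul => (N.load b ω).1
  | .dl => (N.load b ω).2

/-- The uplink users of the user process that are associated with `b`. -/
def ulUsers (N : Network Ω) (p : Params) (b : BS) (ω : Ω) : Set ℕ :=
  {k | p.eta ≤ N.direction k ω ∧ N.server p (.ue k) ω = b}

/-- The uplink user scheduled by `b` in slot `i`. -/
def schedUser (N : Network Ω) (p : Params) (i : ℕ) (b : BS) (ω : Ω) : Device :=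
  .ue (pick (N.ulUsers p b ω) (N.pickUser i b ω))

/-- The SBSs available for backhaul in direction `d` at the MBS number `j`: they are connected to it,
have a user of that direction, and are not the receiver `X*` of the access link considered. -/
def available (N : Network Ω) (p : Params) (d : Dir) (j : ℕ) (ω : Ω) : Set ℕ :=
  {k | N.sbsServer p k ω = j ∧ 0 < N.users d (.s, k) ω ∧ (Tier.s, k) ≠ N.tagged p ω}

/-- The SBS scheduled by the MBS number `j` in slot `i`, of direction `d`. -/
def schedSbs (N : Network Ω) (p : Params) (i : ℕ) (d : Dir) (j : ℕ) (ω : Ω) : ℕ :=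
  pick (N.available p d j ω) (N.pickSbs i j ω)

/-- The SBS number `k` is not scheduled for backhaul in slot `i`, of direction `d`. -/
def unscheduled (N : Network Ω) (p : Params) (i : ℕ) (d : Dir) (k : ℕ) (ω : Ω) : Prop :=
  ¬ ((N.available p d (N.sbsServer p k ω) ω).Nonempty
      ∧ N.schedSbs p i d (N.sbsServer p k ω) ω = k)

/-- Slot `i` is a downlink backhaul slot. -/
def dlBackhaul (N : Network Ω) (p : Params) (i : ℕ) (ω : Ω) : Prop :=
  N.Fa p ω < i ∧ i ≤ N.Fa p ω + N.Fbd p ω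

/-- Slot `i` is an uplink backhaul slot. -/
def ulBackhaul (N : Network Ω) (p : Params) (i : ℕ) (ω : Ω) : Prop :=
  N.Fa p ω + N.Fbd p ω < i ∧ i ≤ p.F

/-! ### Interference and SINR of the uplink access link -/

/-- Interference power received at `X*` from the device `y`. -/
def rx (N : Network Ω) (p : Params) (i : ℕ) (y : Device) (ω : Ω) : ℝ≥0∞ :=
  let x : Device := .bs (N.tagged p ω)
  ENNReal.ofReal (p.C0 * p.pow y.kind * N.fading i x y ω * N.gain i x y ω
    * (N.pathLoss p x y ω)⁻¹)

open Classical in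
/-- Interference from the base stations of tier `t` in an access slot. -/
def accessBS (N : Network Ω) (p : Params) (wa : AccessScheme) (i : ℕ) (t : Tier) (ω : Ω) : ℝ≥0∞ :=
  ∑' k : ℕ, if (t, k) ≠ N.tagged p ω ∧ i ≤ N.Fad p wa (t, k) ω ∧ 0 < N.users .dl (t, k) ω
    then N.rx p i (.bs (t, k)) ω else 0

open Classical in
/-- Interference from uplink users in an access slot. -/
def accessUE (N : Network Ω) (p : Params) (wa : AccessScheme) (i : ℕ) (ω : Ω) : ℝ≥0∞ :=
  ∑' b : BS, if b ≠ N.tagged p ω ∧ N.Fad p wa b ω < i ∧ i ≤ N.Fa p ω ∧ 0 < N.users .ul b ω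
      ∧ (N.ulUsers p b ω).Nonempty
    then N.rx p i (N.schedUser p i b ω) ω else 0

open Classical in
/-- Interference from MBSs in a backhaul slot; the MBS that serves `X*` does not contribute. -/
def backhaulM (N : Network Ω) (p : Params) (i : ℕ) (ω : Ω) : ℝ≥0∞ :=
  ∑' j : ℕ, if N.dlBackhaul p i ω ∧ (N.available p .dl j ω).Nonempty
      ∧ ¬ ((N.tagged p ω).1 = .s ∧ N.sbsServer p (N.tagged p ω).2 ω = j)
    then N.rx p i (.bs (.m, j)) ω else 0

open Classical in
/-- Interference from SBSs in a backhaul slot: those scheduled for uplink backhaul, and under UAB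
those that poach a downlink slot. -/
def backhaulS (N : Network Ω) (p : Params) (wb : BackhaulScheme) (i : ℕ) (ω : Ω) : ℝ≥0∞ :=
  (∑' j : ℕ, if N.ulBackhaul p i ω ∧ (N.available p .ul j ω).Nonempty
    then N.rx p i (.bs (.s, N.schedSbs p i .ul j ω)) ω else 0)
  + ∑' k : ℕ, if wb = .UAB ∧ (Tier.s, k) ≠ N.tagged p ω ∧ N.dlBackhaul p i ω
      ∧ 0 < N.users .dl (.s, k) ω ∧ N.unscheduled p i .dl k ω ∧ N.poach i k ω < p.pDl
    then N.rx p i (.bs (.s, k)) ω else 0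

open Classical in
/-- Interference from uplink users in a backhaul slot: under UAB, those scheduled by SBSs that
poach an uplink slot. -/
def backhaulUE (N : Network Ω) (p : Params) (wb : BackhaulScheme) (i : ℕ) (ω : Ω) : ℝ≥0∞ :=
  ∑' k : ℕ, if wb = .UAB ∧ (Tier.s, k) ≠ N.tagged p ω ∧ N.ulBackhaul p i ω
      ∧ 0 < N.users .ul (.s, k) ω ∧ N.unscheduled p i .ul k ω ∧ N.poach i k ω < p.pUl
      ∧ (N.ulUsers p (.s, k) ω).Nonempty
    then N.rx p i (N.schedUser p i (.s, k) ω) ω else 0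

/-- Total interference power at `X*` in slot `i`. -/
def interference (N : Network Ω) (p : Params) (wa : AccessScheme) (wb : BackhaulScheme) (i : ℕ)
    (ω : Ω) : ℝ≥0∞ :=
  if i ≤ N.Fa p ω
  then N.accessBS p wa i .m ω + N.accessBS p wa i .s ω + N.accessUE p wa i ω
  else N.backhaulM p i ω + N.backhaulS p wb i ω + N.backhaulUE p wb i ω

/-- The SINR of the uplink access link of the typical user in slot `i`. -/
def sinr (N : Network Ω) (p : Params) (wa : AccessScheme) (wb : BackhaulScheme) (i : ℕ) (ω : Ω) :
    ℝ≥0∞ :=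
  ENNReal.ofReal (p.C0 * p.pow .u * N.fading i (.bs (N.tagged p ω)) .typ ω * p.mainGain .u
      * p.mainGain (N.tagged p ω).1.kind * (N.pathLoss p (.bs (N.tagged p ω)) .typ ω)⁻¹)
    / (N.interference p wa wb i ω + ENNReal.ofReal p.noise)

/-- The event that the SINR exceeds `τ`. -/
def covered (N : Network Ω) (p : Params) (wa : AccessScheme) (wb : BackhaulScheme) (i : ℕ)
    (τ : ℝ) : Set Ω :=
  {ω | ENNReal.ofReal τ < N.sinr p wa wb i ω}

/-! ### Distribution of the network -/

/-- The joint law of the network: three Poisson processes and their marks, all independent; fading,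
gains and scheduling may depend on each other across different slots. -/
structure IsModel [MeasurableSpace Ω] (N : Network Ω) (p : Params) (P : Measure Ω) : Prop where
  measurable : ∀ i s, Measurable (N.source i s)
  indep : ∀ i, iIndepFun (N.source i) P
  point : ∀ k, IsPoissonProcess (p.lam k) (N.point k) P
  blockage : ∀ e, P.map (N.blockage e) = unif
  fading : ∀ i x y, P.map (N.fading i x y) = expMeasure 1
  gain : ∀ i x y, P.map (N.gain i x y) = p.gainLaw x.kind y.kind
  load : ∀ b n₁ n₂, P {ω | N.load b ω = (n₁, n₂)}
    = ENNReal.ofReal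
        (p.loadPMF (p.lam .u * N.assocProb p P b.1 / p.lam b.1.kind) n₁ n₂)
  direction : ∀ k, P.map (N.direction k) = unif
  pickUser : ∀ i b, P.map (N.pickUser i b) = unif
  pickSbs : ∀ i j, P.map (N.pickSbs i j) = unif
  poach : ∀ i k, P.map (N.poach i k) = unif
  adCoin : ∀ b, P.map (N.adCoin b) = unif
  frameCoin : ∀ c, P.map (N.frameCoin c) = unif

/-! ### The coverage formula -/

/-- `exp (-s x)` for a possibly infinite `x`, with value `0` at `x = ∞`. -/
def expNeg (s : ℝ) (x : ℝ≥0∞) : ℝ := if x = ∞ then 0 else Real.exp (-s * x.toReal)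

/-- Laplace transform of the interference, given the frame lengths `f`, `X* ∈ Φ_{t,μ}` and
`‖X*‖ = R`. -/
def laplace [MeasurableSpace Ω] (N : Network Ω) (p : Params) (P : Measure Ω) (wa : AccessScheme)
    (wb : BackhaulScheme) (i : ℕ) (f : ℕ × ℕ × ℕ) (t : Tier) (a : Los) (s R : ℝ) : ℝ :=
  ∫ x, expNeg s x
    ∂(condDistrib (N.interference p wa wb i) (N.tagDist p)
        (P[|{ω | N.frame p wa ω = f} ∩ N.typeEvent p t a]) R)

end Network

/-- Probability that no base station of tier `t` and link state `μ` is within distance `R`. -/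
def Params.voidProb (p : Params) (t : Tier) : Los → ℝ → ℝ
  | .l, R => Real.exp (-Real.pi * p.lam t.kind * (p.pLos * min R p.dLos ^ 2))
  | .n, R => Real.exp (-Real.pi * p.lam t.kind * (R ^ 2 - p.pLos * min R p.dLos ^ 2))

/-- Density of the distance to the nearest base station of tier `t` and link state `μ`. -/
def Params.nearestDensity (p : Params) (t : Tier) : Los → ℝ → ℝ
  | .l, R => 2 * Real.pi * p.lam t.kind * R * (p.pLos * (if R ≤ p.dLos then 1 else 0))
      * Real.exp (-Real.pi * p.lam t.kind * p.pLos * min R p.dLos ^ 2)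
  | .n, R => 2 * Real.pi * p.lam t.kind * R * (1 - p.pLos * (if R ≤ p.dLos then 1 else 0))
      * Real.exp (-Real.pi * p.lam t.kind * (R ^ 2 - p.pLos * min R p.dLos ^ 2))

/-- The integral formula for the coverage at threshold `τ` by a base station of tier `t`, given the
frame lengths `f`. -/
def Network.tierCoverage {Ω : Type*} [MeasurableSpace Ω] (N : Network Ω) (p : Params)
    (P : Measure Ω) (wa : AccessScheme) (wb : BackhaulScheme) (i : ℕ) (τ : ℝ) (t : Tier)
    (f : ℕ × ℕ × ℕ) : ℝ :=
  ∑ a : Los, ∫ R in Ioi (0 : ℝ),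
    Real.exp (-τ * R ^ p.alpha a * p.noise
        / (p.C0 * p.pow .u * p.mainGain .u * p.mainGain t.kind))
    * N.laplace p P wa wb i f t a
        (τ * R ^ p.alpha a / (p.C0 * p.pow .u * p.mainGain .u * p.mainGain t.kind)) R
    * (∏ q ∈ (Finset.univ : Finset (Tier × Los)).erase (t, a),
        p.voidProb q.1 q.2
          ((p.pow q.1.kind * p.mainGain q.1.kind * p.bias q.1 * R ^ p.alpha a
              / (p.pow t.kind * p.bias t * p.mainGain t.kind)) ^ (1 / p.alpha q.2)))
    * (p.nearestDensity t a R / N.assocProb p P t)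

/-- The average of the formula over the tier of the serving base station. -/
def Network.coverage {Ω : Type*} [MeasurableSpace Ω] (N : Network Ω) (p : Params)
    (P : Measure Ω) (wa : AccessScheme) (wb : BackhaulScheme) (i : ℕ) (τ : ℝ)
    (f : ℕ × ℕ × ℕ) : ℝ :=
  N.assocProb p P .m * N.tierCoverage p P wa wb i τ .m f
    + N.assocProb p P .s * N.tierCoverage p P wa wb i τ .s f

end MmWave

end

noncomputable section

namespace MmWave

open Filter Topology

/-! Put `s = τ R^α / (C₀ P_u G_u G_t)`, where `R`, `α` and `t` belong to the serving station. The
SINR exceeds `τ` exactly when the fading of the desired link exceeds `s (I + σ²)`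
(`mem_covered_iff`). The typical user never interferes, so this threshold is a function of sources
other than the fadings of links from the typical user. Given those sources, the desired fading is
exponential of mean one, and the coverage probability is `exp(-s σ²) exp(-s I)`. As the receiver
`X*` is itself random, the event is first split over its countably many values
(`measure_covered_inter`).

It remains to average over the distance `R`, given the frame lengths and the type (tier and link
state) of `X*`. The conditional law of `I` given `R` turns `exp(-s I)` into the exact Laplace
transform. The frame coins are independent of positions and blockage, so the law of `R` does not
feel the frame (`measureReal_inter_typeEvent_covered`). The interference is never computed; only its
measurability is needed.

The law of `R` comes from stochastic geometry. Independent thinning by blockage and the generating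
functional of a Poisson process give the void probabilities (`measure_void`). They show that the
nearest distances of the four types are independent, with tails `F_{t,μ}` and densities `f_{t,μ}`
(`iIndepFun_nearest`, `map_nearest`). Up to ties, `X*` has type `q` and distance `R` exactly when
`R` is the nearest distance of type `q` and each other type stays out of its exclusion radius; this
gives the product in the formula (`map_tagDist`). The void probabilities are continuous, so strict
and non-strict exclusion are equally likely and ties do not matter.

The conditional statements follow on summing over link states and tiers. The averaged ones follow on
summing over the countably many frames. -/

/-! ### Measurable selection from random sets -/

theorem not_of_lt_nat_find {q : ℕ → Prop} {inst : DecidablePred q} {h : ∃ n, q n} {m : ℕ}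
    (hm : m < @Nat.find q inst h) : ¬ q m :=
  Nat.find_min h hm

/-- `Encodable.choose` searches the codes upwards. This minimality makes the choice an explicit
function of the set, which measurability needs. -/
theorem Encodable.exists_decode_eq_choose {α : Type*} {p : α → Prop} [Encodable α] [DecidablePred p]
    (h : ∃ x, p x) : ∃ n, Encodable.decode n = some (Encodable.choose h) ∧
      ∀ m < n, ∀ a, Encodable.decode m = some a → ¬ p a := by
  unfold Encodable.choose Encodable.chooseX
  dsimp only
  split
  rename_i a ha heq _
  refine ⟨_, heq, fun m hm a' ha' hp => ?_⟩
  have := not_of_lt_nat_find hm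
  rw [ha'] at this
  exact this hp

theorem Encodable.choose_eq_iff {α : Type*} {p : α → Prop} [Encodable α] [DecidablePred p]
    (h : ∃ x, p x) (b : α) : Encodable.choose h = b ↔ ∃ n, Encodable.decode n = some b ∧ p b ∧
      ∀ m < n, ∀ a, Encodable.decode m = some a → ¬ p a := by
  obtain ⟨n, hn, hmin⟩ := Encodable.exists_decode_eq_choose h
  constructor
  · rintro rfl
    exact ⟨n, hn, Encodable.choose_spec h, hmin⟩
  · rintro ⟨k, hk, hb, hk'⟩
    rcases lt_trichotomy n k with h' | h' | h'
    · exact absurd (Encodable.choose_spec h) (hk' _ h' _ hn)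
    · subst h'; simpa [hn] using hk
    · exact absurd hb (hmin _ h' _ hk)

open Classical in
-- An element is selected iff it lies in `S` and no element of smaller code does: a condition on
-- countably many memberships. It is applied to the random sets of optimal stations in `server` and
-- `sbsServer`.
theorem measurable_encodable_choose {α : Type*} [Encodable α] [MeasurableSpace α] [Countable α]
    [MeasurableSingletonClass α] (d : α) :
    Measurable fun S : Set α => if h : ∃ x, x ∈ S then Encodable.choose h else d := by
  have hmem (a : α) : Measurable fun S : Set α => a ∈ S := measurable_set_mem a
  refine measurable_to_countable' fun b => ?_
  have : (fun S : Set α => if h : ∃ x, x ∈ S then Encodable.choose h else d) ⁻¹' {b}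
      = {S | (∃ x, x ∈ S) ∧ (∃ n, Encodable.decode n = some b ∧ b ∈ S ∧
          ∀ m < n, ∀ a, Encodable.decode m = some a → a ∉ S) ∨ (¬ ∃ x, x ∈ S) ∧ d = b} := by
    ext S
    by_cases h : ∃ x, x ∈ S
    · simp only [Set.mem_preimage, Set.mem_singleton_iff, dif_pos h, Set.mem_ofPred_eq]
      rw [and_iff_right h, or_iff_left (fun h' => h'.1 h)]
      exact Encodable.choose_eq_iff h b
    · simp only [Set.mem_preimage, Set.mem_singleton_iff, dif_neg h, Set.mem_ofPred_eq]
      tauto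
  rw [this]
  measurability

theorem measurable_pick : Measurable fun q : Set ℕ × ℝ => pick q.1 q.2 := by
  classical
  have hmem (a : ℕ) : Measurable fun S : Set ℕ => a ∈ S := measurable_set_mem a
  have hcount (k : ℕ) : Measurable fun S : Set ℕ => Nat.count (· ∈ S) k := by
    simp only [Nat.count_eq_card_filter_range, Finset.card_filter]
    refine Finset.measurable_sum _ fun j _ => Measurable.ite ?_ measurable_const measurable_const
    exact measurableSet_setOfPred.2 (hmem j)
  have hnth : Measurable fun q : Set ℕ × ℕ => Nat.nth (· ∈ q.1) q.2 := by
    refine measurable_from_prod_countable_left fun n => measurable_to_countable' fun k => ?_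
    -- Either `k` belongs to `S` and has exactly `n` smaller elements, or `S` has at most `n`
    -- elements and `Nat.nth` returns its default `0`.
    have : (fun S : Set ℕ => Nat.nth (· ∈ S) n) ⁻¹' {k} =
        {S | (k ∈ S ∧ Nat.count (· ∈ S) k = n) ∨
          (k = 0 ∧ S.encard ≤ (n : ℕ∞))} := by
      ext S
      simp only [Set.mem_preimage, Set.mem_singleton_iff, Set.mem_ofPred_eq]
      by_cases hn : ∀ hf : (Set.ofPred (· ∈ S)).Finite, n < hf.toFinset.card
      · have hc : ¬ S.encard ≤ (n : ℕ∞) := by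
          intro hle
          have hfin : S.Finite := Set.finite_of_encard_le_coe hle
          have := hn hfin
          rw [hfin.encard_eq_coe_toFinset_card] at hle
          exact absurd (by exact_mod_cast hle) (not_le.2 this)
        simp only [hc, and_false, or_false]
        constructor
        · rintro rfl
          exact ⟨Nat.nth_mem n hn, Nat.count_nth hn⟩
        · rintro ⟨h1, h2⟩
          rw [← h2]; exact Nat.nth_count (p := (· ∈ S)) h1
      · push Not at hn
        obtain ⟨hf, hc⟩ := hn
        rw [Nat.nth_of_card_le hf hc]
        have hf' : S.Finite := hf
        have : S.encard ≤ (n : ℕ∞) := by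
          rw [hf'.encard_eq_coe_toFinset_card]; exact_mod_cast hc
        simp only [this, and_true]
        constructor
        · intro h; exact Or.inr h.symm
        · rintro (⟨h1, h2⟩ | h)
          · exfalso
            have := Nat.count_lt_card hf (n := k) h1
            omega
          · exact h.symm
    rw [this]
    have := hmem k
    have := hcount k
    have := measurable_encard (α := ℕ)
    measurability
  unfold pick
  exact hnth.comp (measurable_fst.prodMk (Nat.measurable_floor.comp
    (measurable_snd.mul (measurable_from_nat.comp (measurable_ncard.comp measurable_fst)))))

instance : MeasurableSpace Tier := ⊤

instance : MeasurableSpace Los := ⊤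

instance : DiscreteMeasurableSpace Tier := ⟨fun _ => trivial⟩

instance : DiscreteMeasurableSpace Los := ⟨fun _ => trivial⟩

/-- Quantities attached to `X*`, to a scheduled SBS or to a scheduled user are families evaluated at
a random index. A countable index set reduces their measurability to fixed indices. -/
theorem measurable_eval_countable {Ω ι β : Type*} [MeasurableSpace Ω] [MeasurableSpace ι]
    [Countable ι] [MeasurableSingletonClass ι] [MeasurableSpace β] {g : ι → Ω → β} {T : Ω → ι}
    (hT : Measurable T) (hg : ∀ b, Measurable (g b)) : Measurable fun ω => g (T ω) ω :=
  (measurable_from_prod_countable_right (f := fun q : ι × Ω => g q.1 q.2) hg).comp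
    (hT.prodMk measurable_id)

theorem measurableSet_nonempty_set {Ω α : Type*} [MeasurableSpace Ω] [Countable α] {S : Ω → Set α}
    (hS : Measurable S) : MeasurableSet {ω | (S ω).Nonempty} := by
  have : {ω | (S ω).Nonempty} = ⋃ a, {ω | a ∈ S ω} := by
    ext ω; simp [Set.Nonempty]
  rw [this]
  exact MeasurableSet.iUnion fun a => measurableSet_setOfPred.2 (measurable_set_iff.1 hS a)

theorem Params.measurable_losProb (p : Params) : Measurable p.losProb :=
  Measurable.ite measurableSet_Iic measurable_const measurable_const

theorem measurable_randRound : Measurable fun q : ℝ × ℝ => randRound q.1 q.2 := by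
  unfold randRound
  exact Measurable.ite (measurableSet_lt measurable_snd (measurable_fract.comp measurable_fst))
    (Nat.measurable_ceil.comp measurable_fst) (Nat.measurable_floor.comp measurable_fst)

/-! ### Measurability of the network, for an arbitrary σ-algebra on the sample space -/

namespace Network

variable {Ω : Type*} [MeasurableSpace Ω] {N : Network Ω} {p : Params} {i : ℕ}

/-- The positions of the devices and the blockage variables are measurable. -/
structure GeometryMeasurable (N : Network Ω) : Prop where
  point : ∀ k j, Measurable (N.point k j)
  blockage : ∀ e, Measurable (N.blockage e)

/-- All random elements that enter the interference in slot `i` are measurable. -/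
structure InterferenceMeasurable (N : Network Ω) (i : ℕ) : Prop extends N.GeometryMeasurable where
  -- Interferers are base stations or users of the user process, never `typ`. Leaving out these
  -- fadings keeps the desired one free to be integrated.
  fading : ∀ x y, y ≠ Device.typ → Measurable (N.fading i x y)
  gain : ∀ x y, Measurable (N.gain i x y)
  load : ∀ b, Measurable (N.load b)
  direction : ∀ k, Measurable (N.direction k)
  pickUser : ∀ b, Measurable (N.pickUser i b)
  pickSbs : ∀ j, Measurable (N.pickSbs i j)
  poach : ∀ k, Measurable (N.poach i k)
  adCoin : ∀ b, Measurable (N.adCoin b)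
  frameCoin : ∀ c, Measurable (N.frameCoin c)

theorem GeometryMeasurable.pos (h : N.GeometryMeasurable) (x : Device) : Measurable (N.pos x) := by
  rcases x with b | k | _
  · exact h.point _ _
  · exact h.point _ _
  · exact measurable_const

theorem GeometryMeasurable.los (h : N.GeometryMeasurable) (p : Params) (x y : Device) :
    Measurable (N.los p x y) := by
  classical
  unfold Network.los
  exact Measurable.ite (measurableSet_lt (h.blockage _)
    (p.measurable_losProb.comp ((h.pos x).dist (h.pos y)))) measurable_const measurable_const

theorem GeometryMeasurable.pathLoss (h : N.GeometryMeasurable) (p : Params) (x y : Device) :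
    Measurable (N.pathLoss p x y) :=
  ((h.pos x).dist (h.pos y)).pow (Measurable.of_discrete.comp (h.los p x y))

theorem GeometryMeasurable.biasedPower (h : N.GeometryMeasurable) (p : Params) (b : BS)
    (z : Device) : Measurable (N.biasedPower p b z) :=
  (((h.pathLoss p _ z).inv.const_mul _).mul_const _).mul_const _

theorem GeometryMeasurable.server (h : N.GeometryMeasurable) (p : Params) (z : Device) :
    Measurable (N.server p z) := by
  classical
  have hS : Measurable fun ω => {b : BS | ∀ b', N.biasedPower p b' z ω ≤ N.biasedPower p b z ω} :=
    measurable_set_iff.2 fun b => measurableSet_setOfPred.1 <| by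
      change MeasurableSet {ω | ∀ b', N.biasedPower p b' z ω ≤ N.biasedPower p b z ω}
      rw [Set.ofPred_forall]
      exact MeasurableSet.iInter fun b' =>
        measurableSet_le (h.biasedPower p b' z) (h.biasedPower p b z)
  exact (measurable_encodable_choose (Tier.m, 0)).comp hS

theorem GeometryMeasurable.sbsServer (h : N.GeometryMeasurable) (p : Params) (k : ℕ) :
    Measurable (N.sbsServer p k) := by
  classical
  have hS : Measurable fun ω => {j : ℕ | ∀ j', N.pathLoss p (.bs (.m, j)) (.bs (.s, k)) ω
      ≤ N.pathLoss p (.bs (.m, j')) (.bs (.s, k)) ω} :=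
    measurable_set_iff.2 fun b => measurableSet_setOfPred.1 <| by
      change MeasurableSet {ω | ∀ j', N.pathLoss p (.bs (.m, b)) (.bs (.s, k)) ω
        ≤ N.pathLoss p (.bs (.m, j')) (.bs (.s, k)) ω}
      rw [Set.ofPred_forall]
      exact MeasurableSet.iInter fun b' => measurableSet_le (h.pathLoss p _ _) (h.pathLoss p _ _)
  exact (measurable_encodable_choose 0).comp hS

theorem GeometryMeasurable.tagged (h : N.GeometryMeasurable) (p : Params) :
    Measurable (N.tagged p) := h.server p .typ

theorem GeometryMeasurable.tagDist (h : N.GeometryMeasurable) (p : Params) :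
    Measurable (N.tagDist p) :=
  measurable_eval_countable (g := fun b ω => ‖N.pos (.bs b) ω‖) (h.tagged p) fun _ => (h.pos _).norm

theorem GeometryMeasurable.tagLos (h : N.GeometryMeasurable) (p : Params) :
    Measurable (N.tagLos p) :=
  measurable_eval_countable (g := fun b ω => N.los p (.bs b) .typ ω) (h.tagged p)
    fun _ => h.los p _ _

theorem GeometryMeasurable.tierEvent (h : N.GeometryMeasurable) (p : Params) (t : Tier) :
    MeasurableSet (N.tierEvent p t) :=
  measurableSet_eq_fun (measurable_fst.comp (h.tagged p)) measurable_const

theorem GeometryMeasurable.typeEvent (h : N.GeometryMeasurable) (p : Params) (t : Tier) (a : Los) :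
    MeasurableSet (N.typeEvent p t a) :=
  (h.tierEvent p t).inter (measurableSet_eq_fun (h.tagLos p) measurable_const)

theorem measurable_Fa (h : ∀ c, Measurable (N.frameCoin c)) (p : Params) : Measurable (N.Fa p) :=
  measurable_randRound.comp (measurable_const.prodMk (h 0))

theorem measurable_Fbd (h : ∀ c, Measurable (N.frameCoin c)) (p : Params) : Measurable (N.Fbd p) :=
  measurable_randRound.comp
    (((Measurable.of_discrete (f := fun n : ℕ => p.eta * (p.F - n : ℕ))).comp
      (measurable_Fa h p)).prodMk (h 1))

theorem measurable_FadStatic (h : ∀ c, Measurable (N.frameCoin c)) (p : Params) :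
    Measurable (N.FadStatic p) :=
  measurable_randRound.comp
    (((Measurable.of_discrete (f := fun n : ℕ => p.gammaA * n)).comp
      (measurable_Fa h p)).prodMk (h 2))

theorem measurable_frame (h : ∀ c, Measurable (N.frameCoin c)) (p : Params) (wa : AccessScheme) :
    Measurable (N.frame p wa) := by
  refine (measurable_Fa h p).prodMk ((measurable_Fbd h p).prodMk ?_)
  cases wa
  · exact measurable_FadStatic h p
  · exact measurable_const

namespace InterferenceMeasurable

theorem Fad (h : N.InterferenceMeasurable i) (p : Params) (wa : AccessScheme) (b : BS) :
    Measurable (N.Fad p wa b) := by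
  cases wa
  · exact measurable_FadStatic h.frameCoin p
  · have h1 : Measurable (N.dynShare b) :=
      (Measurable.of_discrete (f := fun n : ℕ × ℕ =>
        if 0 < n.2 then (n.2 : ℝ) / (n.1 + n.2) else 0)).comp (h.load b)
    exact measurable_randRound.comp ((h1.mul
      (measurable_from_nat.comp (measurable_Fa h.frameCoin p))).prodMk (h.adCoin b))

theorem users (h : N.InterferenceMeasurable i) (d : Dir) (b : BS) : Measurable (N.users d b) := by
  cases d
  · exact measurable_fst.comp (h.load b)
  · exact measurable_snd.comp (h.load b)

theorem ulUsers (h : N.InterferenceMeasurable i) (p : Params) (b : BS) :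
    Measurable (N.ulUsers p b) :=
  measurable_set_iff.2 fun k => measurableSet_setOfPred.1 <|
    (measurableSet_le measurable_const (h.direction k)).inter
      (measurableSet_eq_fun (h.server p _) measurable_const)

theorem available (h : N.InterferenceMeasurable i) (p : Params) (d : Dir) (j : ℕ) :
    Measurable (N.available p d j) :=
  measurable_set_iff.2 fun k => measurableSet_setOfPred.1 <|
    (measurableSet_eq_fun (h.sbsServer p k) measurable_const).inter <|
      (measurableSet_lt measurable_const (h.users d _)).inter
        (measurableSet_eq_fun measurable_const (h.tagged p)).compl

theorem rx (h : N.InterferenceMeasurable i) (p : Params) (y : Device) (hy : y ≠ .typ) :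
    Measurable (N.rx p i y) :=
  measurable_eval_countable (g := fun b ω => ENNReal.ofReal (p.C0 * p.pow y.kind
    * N.fading i (.bs b) y ω * N.gain i (.bs b) y ω * (N.pathLoss p (.bs b) y ω)⁻¹)) (h.tagged p)
    fun _ => ((((h.fading _ y hy).const_mul _).mul (h.gain _ y)).mul
      (h.pathLoss p _ y).inv).ennreal_ofReal

theorem rx_schedUser (h : N.InterferenceMeasurable i) (p : Params) (b : BS) :
    Measurable fun ω => N.rx p i (N.schedUser p i b ω) ω :=
  measurable_eval_countable (g := fun k ω => N.rx p i (.ue k) ω)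
    (measurable_pick.comp ((h.ulUsers p b).prodMk (h.pickUser b))) fun k => h.rx p _ (by simp)

theorem schedSbs (h : N.InterferenceMeasurable i) (p : Params) (d : Dir) (j : ℕ) :
    Measurable (N.schedSbs p i d j) :=
  measurable_pick.comp ((h.available p d j).prodMk (h.pickSbs j))

theorem unscheduled (h : N.InterferenceMeasurable i) (p : Params) (d : Dir) (k : ℕ) :
    MeasurableSet {ω | N.unscheduled p i d k ω} := by
  refine (MeasurableSet.inter ?_ ?_).compl
  · exact measurableSet_nonempty_set
      (measurable_eval_countable (h.sbsServer p k) fun j => h.available p d j)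
  · exact measurableSet_eq_fun
      (measurable_eval_countable (h.sbsServer p k) fun j => h.schedSbs p d j) measurable_const

theorem dlBackhaul (h : N.InterferenceMeasurable i) (p : Params) :
    MeasurableSet {ω | N.dlBackhaul p i ω} :=
  (measurableSet_lt (measurable_Fa h.frameCoin p) measurable_const).inter
    (measurableSet_le measurable_const
      ((measurable_Fa h.frameCoin p).add (measurable_Fbd h.frameCoin p)))

theorem ulBackhaul (h : N.InterferenceMeasurable i) (p : Params) :
    MeasurableSet {ω | N.ulBackhaul p i ω} :=
  (measurableSet_lt ((measurable_Fa h.frameCoin p).add (measurable_Fbd h.frameCoin p))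
    measurable_const).inter (.const _)

theorem ne_tagged (h : N.InterferenceMeasurable i) (p : Params) (b : BS) :
    MeasurableSet {ω | b ≠ N.tagged p ω} :=
  (measurableSet_eq_fun measurable_const (h.tagged p)).compl

theorem users_pos (h : N.InterferenceMeasurable i) (d : Dir) (b : BS) :
    MeasurableSet {ω | 0 < N.users d b ω} :=
  measurableSet_lt measurable_const (h.users d b)

theorem accessBS (h : N.InterferenceMeasurable i) (p : Params) (wa : AccessScheme) (t : Tier) :
    Measurable (N.accessBS p wa i t) := by
  classical
  refine Measurable.tsum fun k => Measurable.ite ?_ (h.rx p _ (by simp)) measurable_const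
  exact (h.ne_tagged p _).inter
    ((measurableSet_le measurable_const (h.Fad p wa _)).inter (h.users_pos _ _))

theorem accessUE (h : N.InterferenceMeasurable i) (p : Params) (wa : AccessScheme) :
    Measurable (N.accessUE p wa i) := by
  classical
  refine Measurable.tsum fun b => Measurable.ite ?_ (h.rx_schedUser p b) measurable_const
  exact (h.ne_tagged p _).inter ((measurableSet_lt (h.Fad p wa _) measurable_const).inter
    ((measurableSet_le measurable_const (measurable_Fa h.frameCoin p)).inter
      ((h.users_pos _ _).inter (measurableSet_nonempty_set (h.ulUsers p b)))))

theorem backhaulM (h : N.InterferenceMeasurable i) (p : Params) :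
    Measurable (N.backhaulM p i) := by
  classical
  refine Measurable.tsum fun j => Measurable.ite ?_ (h.rx p _ (by simp)) measurable_const
  refine (h.dlBackhaul p).inter ((measurableSet_nonempty_set (h.available p _ j)).inter
    ((h.tierEvent p .s).inter ?_).compl)
  exact measurableSet_eq_fun (measurable_eval_countable (measurable_snd.comp (h.tagged p))
    fun k => h.sbsServer p k) measurable_const

theorem backhaulS (h : N.InterferenceMeasurable i) (p : Params) (wb : BackhaulScheme) :
    Measurable (N.backhaulS p wb i) := by
  classical
  refine Measurable.add (Measurable.tsum fun j => Measurable.ite ?_ ?_ measurable_const)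
    (Measurable.tsum fun k => Measurable.ite ?_ (h.rx p _ (by simp)) measurable_const)
  · exact (h.ulBackhaul p).inter (measurableSet_nonempty_set (h.available p _ j))
  · exact measurable_eval_countable (g := fun k ω => N.rx p i (.bs (.s, k)) ω)
      (h.schedSbs p .ul j) fun k => h.rx p _ (by simp)
  · exact (MeasurableSet.const _).inter ((h.ne_tagged p _).inter ((h.dlBackhaul p).inter
      ((h.users_pos _ _).inter ((h.unscheduled p _ k).inter
        (measurableSet_lt (h.poach k) measurable_const)))))

theorem backhaulUE (h : N.InterferenceMeasurable i) (p : Params) (wb : BackhaulScheme) :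
    Measurable (N.backhaulUE p wb i) := by
  classical
  refine Measurable.tsum fun k => Measurable.ite ?_ (h.rx_schedUser p _) measurable_const
  exact (MeasurableSet.const _).inter ((h.ne_tagged p _).inter ((h.ulBackhaul p).inter
    ((h.users_pos _ _).inter ((h.unscheduled p _ k).inter
      ((measurableSet_lt (h.poach k) measurable_const).inter
        (measurableSet_nonempty_set (h.ulUsers p _)))))))

theorem interference (h : N.InterferenceMeasurable i) (p : Params) (wa : AccessScheme)
    (wb : BackhaulScheme) : Measurable (N.interference p wa wb i) :=
  Measurable.ite (measurableSet_le measurable_const (measurable_Fa h.frameCoin p))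
    (((h.accessBS p wa .m).add (h.accessBS p wa .s)).add (h.accessUE p wa))
    (((h.backhaulM p).add (h.backhaulS p wb)).add (h.backhaulUE p wb))

end InterferenceMeasurable

end Network

/-! ### Poisson counts and generating functionals -/

/-- The Poisson weights of the finite values already sum to one, so the value `⊤` is null and the
count has a Poisson law; the exponential series then gives its generating function. -/
theorem lintegral_pow_toNat_of_poisson {Ω : Type*} [MeasurableSpace Ω] {P : Measure Ω}
    [IsProbabilityMeasure P] {c : Ω → ℕ∞} (hc : Measurable c) {r : ℝ≥0}
    (h : ∀ n : ℕ, P {ω | c ω = n} = poissonMeasure r {n}) :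
    (∀ᵐ ω ∂P, c ω ≠ ⊤) ∧
    ∀ v : ℝ≥0, ∫⁻ ω, (v : ℝ≥0∞) ^ (c ω).toNat ∂P = ENNReal.ofReal (Real.exp (-(r * (1 - v)))) := by
  have hset (x : ℕ∞) : MeasurableSet {ω | c ω = x} := hc (measurableSet_singleton x)
  have hsum : ∑' n : ℕ, P {ω | c ω = n} = 1 := by
    simp_rw [h]
    have := lintegral_countable' (μ := poissonMeasure r) (fun _ : ℕ => (1 : ℝ≥0∞))
    simpa using this.symm
  have hdisj : Pairwise (Function.onFun Disjoint fun n : ℕ => {ω | c ω = n}) := by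
    intro m n hmn
    refine Set.disjoint_left.2 fun ω hm hn => hmn ?_
    have : ((m : ℕ) : ℕ∞) = n := hm.symm.trans hn
    exact_mod_cast this
  have hU : P (⋃ n : ℕ, {ω | c ω = n}) = 1 := by
    rw [measure_iUnion hdisj fun n => hset n, hsum]
  have hfin : ∀ᵐ ω ∂P, c ω ≠ ⊤ := by
    have := (prob_compl_eq_zero_iff (MeasurableSet.iUnion fun n : ℕ => hset n)).2 hU
    refine measure_mono_null (fun ω hω => ?_) this
    simp only [Set.mem_compl_iff, Set.mem_ofPred_eq, not_not] at hω
    simp [hω]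
  refine ⟨hfin, fun v => ?_⟩
  have hmap : P.map (fun ω => (c ω).toNat) = poissonMeasure r := by
    have hmeas : Measurable fun ω => (c ω).toNat := Measurable.of_discrete.comp hc
    refine Measure.ext_of_singleton fun n => ?_
    rw [Measure.map_apply hmeas (measurableSet_singleton n), ← h n]
    refine measure_congr ?_
    filter_upwards [hfin] with ω hω
    refine propext ?_
    change (c ω).toNat = n ↔ c ω = n
    constructor
    · intro h'; rw [← h', ENat.natCast_toNat hω]
    · intro h'; rw [h']; rfl
  have hmeas : Measurable fun ω => (c ω).toNat := Measurable.of_discrete.comp hc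
  rw [← lintegral_map (f := fun n : ℕ => (v : ℝ≥0∞) ^ n) Measurable.of_discrete hmeas, hmap,
    lintegral_countable']
  simp_rw [poissonMeasure_singleton]
  have hterm (n : ℕ) : (v : ℝ≥0∞) ^ n * ENNReal.ofReal (Real.exp (-r) * r ^ n / n.factorial)
      = ENNReal.ofReal (Real.exp (-r) * ((r * v : ℝ) ^ n / n.factorial)) := by
    rw [← ENNReal.ofReal_coe_nnreal, ← ENNReal.ofReal_pow v.coe_nonneg,
      ← ENNReal.ofReal_mul (pow_nonneg v.coe_nonneg n)]
    congr 1; rw [mul_pow]; ring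
  simp_rw [hterm]
  have hs := (NormedSpace.expSeries_div_hasSum_exp (r * v : ℝ)).mul_left (Real.exp (-r))
  rw [← ENNReal.ofReal_tsum_of_nonneg (fun n => by positivity) hs.summable, hs.tsum_eq,
    ← Real.exp_eq_exp_ℝ, ← Real.exp_add]
  congr 2; ring

namespace IsPoissonProcess

variable {Ω : Type*} [MeasurableSpace Ω] {P : Measure Ω} {lam : ℝ}
  {X : ℕ → Ω → Plane}

theorem measurable_encard (hX : IsPoissonProcess lam X P) {A : Set Plane} (hA : MeasurableSet A) :
    Measurable fun ω => {k | X k ω ∈ A}.encard :=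
  _root_.measurable_encard.comp <| measurable_set_iff.2 fun k => measurableSet_setOfPred.1 <|
    hX.measurable k hA

variable [IsProbabilityMeasure P]

theorem ae_finite (hX : IsPoissonProcess lam X P) {A : Set Plane} (hA : MeasurableSet A)
    (hb : Bornology.IsBounded A) : ∀ᵐ ω ∂P, {k | X k ω ∈ A}.Finite := by
  filter_upwards [(lintegral_pow_toNat_of_poisson (hX.measurable_encard hA)
    (hX.poisson A hA hb)).1] with ω hω
  exact Set.encard_ne_top_iff.1 hω

theorem lintegral_pow_ncard (hX : IsPoissonProcess lam X P) (hlam : 0 ≤ lam) {A : Set Plane}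
    (hA : MeasurableSet A) (hb : Bornology.IsBounded A) (v : ℝ≥0) :
    ∫⁻ ω, (v : ℝ≥0∞) ^ {k | X k ω ∈ A}.ncard ∂P
      = ENNReal.ofReal (Real.exp (-(lam * ((1 - v) * volume.real A)))) := by
  have := (lintegral_pow_toNat_of_poisson (hX.measurable_encard hA) (hX.poisson A hA hb)).2 v
  refine this.trans ?_
  rw [Real.coe_toNNReal _ (mul_nonneg hlam ENNReal.toReal_nonneg), Measure.real]
  congr 3; ring

/-- The probability generating functional of a Poisson process at a function with finitely many
values. -/
theorem tendsto_lintegral_prod (hX : IsPoissonProcess lam X P) (hlam : 0 ≤ lam) {w : Plane → ℝ≥0}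
    (hw : Measurable w) (hw1 : ∀ x, w x ≤ 1) (hfin : (range w).Finite)
    (hb : Bornology.IsBounded {x | w x ≠ 1}) :
    Tendsto (fun n => ∫⁻ ω, ∏ k ∈ Finset.range n, (w (X k ω) : ℝ≥0∞) ∂P) atTop
      (𝓝 (ENNReal.ofReal (Real.exp (-(lam * ∫ x, (1 - (w x : ℝ))))))) := by
  classical
  -- The value `1` is left out: it contributes neither to the product nor to `∫ (1 - w)`, and its
  -- level set is unbounded. The other level sets are bounded, with independent Poisson counts.
  set S : Finset ℝ≥0 := hfin.toFinset.erase 1 with hS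
  let e : Fin S.card ≃ S := S.equivFin.symm
  let A : Fin S.card → Set Plane := fun j => w ⁻¹' {(e j : ℝ≥0)}
  have hne (j) : (e j : ℝ≥0) ≠ 1 := Finset.ne_of_mem_erase (e j).2
  have hA (j) : MeasurableSet (A j) := hw (measurableSet_singleton _)
  have hAb (j) : Bornology.IsBounded (A j) := hb.subset fun x hx => by
    change w x ≠ 1
    rw [show w x = e j from hx]; exact hne j
  have hAfin (j) : volume (A j) ≠ ∞ := (hAb j).measure_lt_top.ne
  have hdisj : Pairwise fun i j => Disjoint (A i) (A j) := fun i j hij =>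
    Set.disjoint_left.2 fun x hi hj => hij (e.injective (Subtype.ext (hi.symm.trans hj)))
  have hlim : ∫⁻ ω, ∏ j, ((e j : ℝ≥0) : ℝ≥0∞) ^ {k | X k ω ∈ A j}.ncard ∂P
      = ENNReal.ofReal (Real.exp (-(lam * ∫ x, (1 - (w x : ℝ))))) := by
    have hind := (hX.indep _ A hA hdisj).comp
      (fun j n => ((e j : ℝ≥0) : ℝ≥0∞) ^ n.toNat) fun j => Measurable.of_discrete
    have hprod := lintegral_prod_eq_prod_lintegral_of_indepFun Finset.univ _ hind
      fun j => Measurable.of_discrete.comp (hX.measurable_encard (hA j))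
    refine hprod.trans ?_
    have h1 (j) := hX.lintegral_pow_ncard hlam (hA j) (hAb j) (e j)
    refine (Finset.prod_congr rfl fun j _ => h1 j).trans ?_
    rw [← ENNReal.ofReal_prod_of_nonneg fun _ _ => (Real.exp_pos _).le, ← Real.exp_sum]
    congr 2
    rw [Finset.sum_neg_distrib, ← Finset.mul_sum]
    congr 2
    have hpt (x : Plane) : 1 - (w x : ℝ)
        = ∑ j, (A j).indicator (fun _ => 1 - ((e j : ℝ≥0) : ℝ)) x := by
      by_cases hx : w x = 1
      · rw [hx, NNReal.coe_one, sub_self]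
        refine (Finset.sum_eq_zero fun j _ => Set.indicator_of_notMem (fun h => hne j ?_) _).symm
        exact (show w x = e j from h).symm.trans hx
      · have hxS : w x ∈ S := Finset.mem_erase.2 ⟨hx, hfin.mem_toFinset.2 ⟨x, rfl⟩⟩
        have hj : x ∈ A (e.symm ⟨w x, hxS⟩) := by
          change w x = e (e.symm ⟨w x, hxS⟩)
          rw [e.apply_symm_apply]
        rw [Finset.sum_eq_single (e.symm ⟨w x, hxS⟩), Set.indicator_of_mem hj, e.apply_symm_apply]
        · intro j _ hjne
          exact Set.indicator_of_notMem (fun h => Set.disjoint_left.1 (hdisj hjne) h hj) _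
        · simp
    simp_rw [hpt]
    rw [integral_finsetSum _ fun j _ => (integrable_indicator_iff (hA j)).2
      (integrableOn_const (hAfin j))]
    refine Finset.sum_congr rfl fun j _ => ?_
    rw [integral_indicator_const _ (hA j), smul_eq_mul, mul_comm]
  rw [← hlim]
  refine tendsto_lintegral_of_dominated_convergence (fun _ => 1) (fun n => ?_) (fun n => ?_)
    (by simp) ?_
  · exact Finset.measurable_prod _ fun k _ => (hw.comp (hX.measurable k)).coe_nnreal_ennreal
  · exact ae_of_all _ fun ω => Finset.prod_le_one' fun k _ => by exact_mod_cast hw1 _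
  -- Almost surely only finitely many points have `w ≠ 1`, so the partial products are eventually
  -- constant; grouping the points by the value of `w` gives the limit.
  · have hK : ∀ᵐ ω ∂P, {k | X k ω ∈ {x | w x ≠ 1}}.Finite :=
      hX.ae_finite (hw (measurableSet_singleton (1 : ℝ≥0))).compl hb
    filter_upwards [hK] with ω hω
    refine tendsto_const_nhds.congr' ?_
    obtain ⟨n₀, hn₀⟩ := hω.bddAbove
    filter_upwards [eventually_gt_atTop n₀] with n hn
    have hsub : hω.toFinset ⊆ Finset.range n := fun k hk =>
      Finset.mem_range.2 ((hn₀ (hω.mem_toFinset.1 hk)).trans_lt hn)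
    rw [← Finset.prod_subset hsub fun k _ hk => ?_]
    · rw [← Finset.prod_fiberwise_of_maps_to (t := S) (g := fun k => w (X k ω)) fun k hk =>
        Finset.mem_erase.2 ⟨hω.mem_toFinset.1 hk, hfin.mem_toFinset.2 ⟨_, rfl⟩⟩,
        ← Finset.prod_coe_sort S, ← e.prod_comp]
      refine Finset.prod_congr rfl fun j _ => ?_
      rw [Finset.prod_congr rfl (g := fun _ => ((e j : ℝ≥0) : ℝ≥0∞)) fun k hk => by
        rw [(Finset.mem_filter.1 hk).2], Finset.prod_const]
      congr 1
      rw [← Set.ncard_coe_finset]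
      congr 1
      ext k
      simp only [Finset.coe_filter, Set.mem_ofPred_eq, Set.Finite.mem_toFinset, A, Set.mem_preimage,
        Set.mem_singleton_iff]
      constructor
      · intro h; exact ⟨h ▸ hne j, h⟩
      · exact fun h => h.2
    · have : w (X k ω) = 1 := by
        by_contra h
        exact hk (hω.mem_toFinset.2 h)
      simp [this]

end IsPoissonProcess

/-- Freezing principle: what is measurable for `m` is held fixed while `U`, independent of `m`, is
integrated out. It serves for the blockage variables, for the nearest distances and for the desired
fading. -/
theorem lintegral_comp_prodMk_of_indep {Ω α β : Type*} [MeasurableSpace α] [MeasurableSpace β]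
    {m mΩ : MeasurableSpace Ω} {P : Measure Ω} [IsFiniteMeasure P] {U : Ω → α} {Z : Ω → β}
    (hm : m ≤ mΩ) (hU : Measurable U) (h : Indep (MeasurableSpace.comap U inferInstance) m P)
    (hZ : Measurable[m] Z) {f : α × β → ℝ≥0∞} (hf : Measurable f) :
    ∫⁻ ω, f (U ω, Z ω) ∂P = ∫⁻ ω, ∫⁻ u, f (u, Z ω) ∂(P.map U) ∂P := by
  have hZ' : Measurable Z := hZ.mono hm le_rfl
  have hind : IndepFun U Z P := indep_of_indep_of_le_right h hZ.comap_le
  rw [indepFun_iff_map_prod_eq_prod_map_map hU.aemeasurable hZ'.aemeasurable] at hind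
  rw [← lintegral_map (f := f) hf (hU.prodMk hZ'), hind, lintegral_prod_symm' _ hf,
    lintegral_map hf.lintegral_prod_left' hZ']

/-! ### Independent sources of randomness -/

namespace Network

variable {Ω : Type*}

/-- The σ-algebra generated by a set of sources of randomness. -/
abbrev sourceSigma (N : Network Ω) (i : ℕ) (S : Set Source) : MeasurableSpace Ω :=
  ⨆ s ∈ S, MeasurableSpace.comap (N.source i s) inferInstance

theorem measurable_source_sourceSigma (N : Network Ω) (i : ℕ) {S : Set Source} {s : Source}
    (hs : s ∈ S) : Measurable[N.sourceSigma i S] (N.source i s) :=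
  Measurable.mono (comap_measurable _) (le_iSup₂_of_le s hs le_rfl) le_rfl

theorem geometryMeasurable_of_source (N : Network Ω) (i : ℕ) {S : Set Source}
    (hp : ∀ k, .point k ∈ S) (hb : ∀ e, .blockage e ∈ S) :
    @GeometryMeasurable Ω (N.sourceSigma i S) N :=
  letI := N.sourceSigma i S
  { point := fun k j => (measurable_pi_apply j).comp (N.measurable_source_sourceSigma i (hp k))
    blockage := fun e => N.measurable_source_sourceSigma i (hb e) }

/-- Taking `sourceSigma` as the ambient σ-algebra, all earlier measurability results say that the
interference is a function of the chosen sources. Any set of sources works that omits at most the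
fadings of links from the typical user. -/
theorem interferenceMeasurable_of_source (N : Network Ω) (i : ℕ) {S : Set Source}
    (hS : ∀ s, (∀ x, s ≠ .fading x .typ) → s ∈ S) :
    @InterferenceMeasurable Ω (N.sourceSigma i S) N i :=
  letI := N.sourceSigma i S
  have h (s : Source) (hs : ∀ x, s ≠ .fading x .typ) : Measurable (N.source i s) :=
    N.measurable_source_sourceSigma i (hS s hs)
  { N.geometryMeasurable_of_source i (fun _ => hS _ (by simp)) (fun _ => hS _ (by simp)) with
    fading := fun x y hy => h (.fading x y) fun z hz => hy (by injection hz)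
    gain := fun x y => h (.gain x y) (by simp)
    load := fun b => h (.load b) (by simp)
    direction := fun k => h (.direction k) (by simp)
    pickUser := fun b => h (.pickUser b) (by simp)
    pickSbs := fun j => h (.pickSbs j) (by simp)
    poach := fun k => h (.poach k) (by simp)
    adCoin := fun b => h (.adCoin b) (by simp)
    frameCoin := fun c => h (.frameCoin c) (by simp) }

namespace IsModel

variable [MeasurableSpace Ω] {P : Measure Ω} {p : Params} {N : Network Ω}

theorem sourceSigma_le (hN : N.IsModel p P) (i : ℕ) (S : Set Source) :
    N.sourceSigma i S ≤ ‹MeasurableSpace Ω› :=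
  iSup₂_le fun s _ => (hN.measurable i s).comap_le

theorem indep_sourceSigma (hN : N.IsModel p P) (i : ℕ) {S T : Set Source} (h : Disjoint S T) :
    Indep (N.sourceSigma i S) (N.sourceSigma i T) P :=
  indep_iSup_of_disjoint (fun s => (hN.measurable i s).comap_le) (hN.indep i) h

theorem indep_source (hN : N.IsModel p P) (i : ℕ) (s : Source) :
    Indep (MeasurableSpace.comap (N.source i s) inferInstance) (N.sourceSigma i {s}ᶜ) P := by
  have := hN.indep_sourceSigma i (disjoint_compl_right (a := ({s} : Set Source)))
  simpa [sourceSigma] using this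

theorem geometryMeasurable (hN : N.IsModel p P) : N.GeometryMeasurable where
  point k j := (measurable_pi_apply j).comp (hN.measurable 0 (.point k))
  blockage e := hN.measurable 0 (.blockage e)

theorem interferenceMeasurable (hN : N.IsModel p P) (i : ℕ) : N.InterferenceMeasurable i :=
  { hN.geometryMeasurable with
    fading := fun x y _ => hN.measurable i (.fading x y)
    gain := fun x y => hN.measurable i (.gain x y)
    load := fun b => hN.measurable i (.load b)
    direction := fun k => hN.measurable i (.direction k)
    pickUser := fun b => hN.measurable i (.pickUser b)
    pickSbs := fun j => hN.measurable i (.pickSbs j)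
    poach := fun k => hN.measurable i (.poach k)
    adCoin := fun b => hN.measurable i (.adCoin b)
    frameCoin := fun c => hN.measurable i (.frameCoin c) }

end IsModel

end Network

/-! ### Void probabilities -/

/-- Points and blockage variables of a tier for which the link to the origin does not have a state
`μ` at distance below `r μ`. -/
def Params.allowed (p : Params) (r : Los → ℝ) : Set (Plane × ℝ) :=
  {q | r (if q.2 < p.losProb ‖q.1‖ then .l else .n) ≤ ‖q.1‖}

/-- Probability that a base station at distance `d` is not one with state `μ` closer than `r μ`. -/
def Params.allowedProb (p : Params) (r : Los → ℝ) (d : ℝ) : ℝ :=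
  (if r .l ≤ d then p.losProb d else 0) + (if r .n ≤ d then 1 - p.losProb d else 0)

theorem Params.losProb_mem (p : Params) (d : ℝ) : p.losProb d ∈ Icc (0 : ℝ) 1 := by
  unfold losProb
  split_ifs
  · exact p.pLos_mem
  · simp

theorem Params.measurableSet_allowed (p : Params) (r : Los → ℝ) :
    MeasurableSet (p.allowed r) := by
  refine measurableSet_le ((Measurable.of_discrete (f := r)).comp
    (Measurable.ite (measurableSet_lt measurable_snd
      (p.measurable_losProb.comp measurable_fst.norm)) measurable_const measurable_const))
    measurable_fst.norm

theorem unif_Iio {a : ℝ} (ha : a ∈ Icc (0 : ℝ) 1) : unif (Iio a) = ENNReal.ofReal a := by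
  have : Iio a ∩ Icc (0 : ℝ) 1 = Ico 0 a := by
    ext x
    simp only [mem_inter_iff, mem_Iio, mem_Icc, mem_Ico]
    exact ⟨fun h => ⟨h.2.1, h.1⟩, fun h => ⟨h.2, h.1, h.2.le.trans ha.2⟩⟩
  rw [unif, Measure.restrict_apply measurableSet_Iio, this, Real.volume_Ico, sub_zero]

theorem unif_Ici {a : ℝ} (ha : a ∈ Icc (0 : ℝ) 1) : unif (Ici a) = ENNReal.ofReal (1 - a) := by
  have : Ici a ∩ Icc (0 : ℝ) 1 = Icc a 1 := by
    ext x
    simp only [mem_inter_iff, mem_Ici, mem_Icc]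
    exact ⟨fun h => ⟨h.1, h.2.2⟩, fun h => ⟨h.1, ha.1.trans h.1, h.2⟩⟩
  rw [unif, Measure.restrict_apply measurableSet_Ici, this, Real.volume_Icc]

/-- The section at `x` is the line, a lower ray, an upper ray or empty, according to which of the
two states are admissible at distance `‖x‖`. -/
theorem Params.unif_allowed (p : Params) (r : Los → ℝ) (x : Plane) :
    unif {u | (x, u) ∈ p.allowed r} = ENNReal.ofReal (p.allowedProb r ‖x‖) := by
  have hmem := p.losProb_mem ‖x‖
  simp only [allowed, allowedProb, mem_ofPred_eq]
  by_cases hl : r .l ≤ ‖x‖ <;> by_cases hn : r .n ≤ ‖x‖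
  · have : {u : ℝ | r (if u < p.losProb ‖x‖ then .l else .n) ≤ ‖x‖} = univ := by
      ext u; simp only [mem_ofPred_eq, mem_univ, iff_true]; split_ifs <;> assumption
    rw [this, if_pos hl, if_pos hn]; simp [unif]
  · have : {u : ℝ | r (if u < p.losProb ‖x‖ then .l else .n) ≤ ‖x‖} = Iio (p.losProb ‖x‖) := by
      ext u; simp only [mem_ofPred_eq, mem_Iio]; split_ifs with h <;> simp [*]
    rw [this, if_pos hl, if_neg hn, add_zero, unif_Iio hmem]
  · have : {u : ℝ | r (if u < p.losProb ‖x‖ then .l else .n) ≤ ‖x‖} = Ici (p.losProb ‖x‖) := by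
      ext u; simp only [mem_ofPred_eq, mem_Ici]; split_ifs with h
      · exact iff_of_false hl (not_le.2 h)
      · exact iff_of_true hn (not_lt.1 h)
    rw [this, if_neg hl, if_pos hn, zero_add, unif_Ici hmem]
  · have : {u : ℝ | r (if u < p.losProb ‖x‖ then .l else .n) ≤ ‖x‖} = ∅ := by
      ext u; simp only [mem_ofPred_eq, mem_empty_iff_false, iff_false]; split_ifs <;> assumption
    rw [this, if_neg hl, if_neg hn]; simp

theorem Params.measurable_allowedProb (p : Params) (r : Los → ℝ) :
    Measurable (p.allowedProb r) :=
  (Measurable.ite measurableSet_Ici p.measurable_losProb measurable_const).add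
    (Measurable.ite measurableSet_Ici (p.measurable_losProb.const_sub 1) measurable_const)

theorem Params.allowedProb_mem (p : Params) (r : Los → ℝ) (d : ℝ) :
    p.allowedProb r d ∈ Icc (0 : ℝ) 1 := by
  have := p.losProb_mem d
  rw [mem_Icc] at *
  unfold allowedProb
  split_ifs <;> constructor <;> linarith

namespace Network.IsModel

variable {Ω : Type*} [MeasurableSpace Ω] {P : Measure Ω} [IsProbabilityMeasure P] {p : Params}
  {N : Network Ω}

/-- Independent thinning: the blockage variables are independent of each other and of the positions,
so they can be integrated one at a time with the positions frozen. The factor `Z` serves the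
induction: it absorbs the factor produced by each link already integrated. -/
theorem lintegral_mul_prod_indicator_allowed (hN : N.IsModel p P) (r : Tier → Los → ℝ)
    (J : Finset BS) {Z : Ω → ℝ≥0∞}
    (hZ : Measurable[N.sourceSigma 0 (range Source.point)] Z) :
    ∫⁻ ω, Z ω * ∏ b ∈ J, (p.allowed (r b.1)).indicator 1
        (N.pos (.bs b) ω, N.blockage s(.bs b, .typ) ω) ∂P
      = ∫⁻ ω, Z ω * ∏ b ∈ J, ENNReal.ofReal (p.allowedProb (r b.1) ‖N.pos (.bs b) ω‖) ∂P := by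
  classical
  have hpos (S : Set Source) (hS : range Source.point ⊆ S) (b : BS) :
      Measurable[N.sourceSigma 0 S] (N.pos (.bs b)) :=
    letI := N.sourceSigma 0 S
    (measurable_pi_apply b.2).comp (N.measurable_source_sourceSigma 0 (hS ⟨b.1.kind, rfl⟩))
  induction J using Finset.induction_on generalizing Z with
  | empty => simp
  | insert b J hb ih =>
    simp_rw [Finset.prod_insert hb]
    set s : Source := .blockage s(.bs b, .typ) with hs
    have hpt : range Source.point ⊆ ({s}ᶜ : Set Source) := by rintro _ ⟨k, rfl⟩; simp [hs]
    have hle : N.sourceSigma 0 (range Source.point) ≤ N.sourceSigma 0 {s}ᶜ :=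
      iSup₂_le fun t ht => le_iSup₂_of_le t (hpt ht) le_rfl
    have hZ' : Measurable[N.sourceSigma 0 {s}ᶜ] fun ω => (Z ω * ∏ b ∈ J,
        (p.allowed (r b.1)).indicator 1 (N.pos (.bs b) ω, N.blockage s(.bs b, .typ) ω),
        N.pos (.bs b) ω) := by
      let _ := N.sourceSigma 0 {s}ᶜ
      refine Measurable.prodMk ((hZ.mono hle le_rfl).mul ?_) (hpos _ hpt b)
      refine Finset.measurable_prod _ fun b' hb' => ?_
      refine (measurable_one.indicator (p.measurableSet_allowed _)).comp
        ((hpos _ hpt b').prodMk ?_)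
      have hmem : Source.blockage s(.bs b', .typ) ∈ ({s}ᶜ : Set Source) := by
        have : b' ≠ b := fun h => hb (h ▸ hb')
        simpa [hs] using this
      exact N.measurable_source_sourceSigma 0 hmem
    have key := lintegral_comp_prodMk_of_indep (P := P) (hN.sourceSigma_le 0 _)
      (hN.measurable 0 s) (hN.indep_source 0 s) hZ'
      (f := fun q : ℝ × ℝ≥0∞ × Plane => q.2.1 * (p.allowed (r b.1)).indicator 1 (q.2.2, q.1))
      ((measurable_fst.comp measurable_snd).mul
        ((measurable_one.indicator (p.measurableSet_allowed _)).comp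
          ((measurable_snd.comp measurable_snd).prodMk measurable_fst)))
    have hmap : P.map (N.source 0 s) = unif := hN.blockage _
    have hin (x : Plane) : ∫⁻ u, (p.allowed (r b.1)).indicator (1 : Plane × ℝ → ℝ≥0∞) (x, u) ∂unif
        = ENNReal.ofReal (p.allowedProb (r b.1) ‖x‖) := by
      rw [← p.unif_allowed]
      exact lintegral_indicator_one (measurable_prodMk_left (p.measurableSet_allowed _))
    rw [hmap] at key
    have hconst (z : ℝ≥0∞) (x : Plane) :
        ∫⁻ u, z * (p.allowed (r b.1)).indicator (1 : Plane × ℝ → ℝ≥0∞) (x, u) ∂unif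
          = z * ENNReal.ofReal (p.allowedProb (r b.1) ‖x‖) := by
      rw [← hin]
      exact lintegral_const_mul _ ((measurable_one.indicator (p.measurableSet_allowed _)).comp
        measurable_prodMk_left)
    have hW : Measurable[N.sourceSigma 0 (range Source.point)] fun ω =>
        Z ω * ENNReal.ofReal (p.allowedProb (r b.1) ‖N.pos (.bs b) ω‖) := by
      let _ := N.sourceSigma 0 (range Source.point)
      exact hZ.mul ((p.measurable_allowedProb _).comp (hpos _ subset_rfl b).norm).ennreal_ofReal
    calc _ = ∫⁻ ω, (Z ω * ∏ b ∈ J, (p.allowed (r b.1)).indicator 1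
              (N.pos (.bs b) ω, N.blockage s(.bs b, .typ) ω))
            * (p.allowed (r b.1)).indicator 1
              (N.pos (.bs b) ω, N.blockage s(.bs b, .typ) ω) ∂P :=
          lintegral_congr fun ω => by ring
      _ = _ := key
      _ = ∫⁻ ω, (Z ω * ENNReal.ofReal (p.allowedProb (r b.1) ‖N.pos (.bs b) ω‖))
            * ∏ b ∈ J, (p.allowed (r b.1)).indicator 1
              (N.pos (.bs b) ω, N.blockage s(.bs b, .typ) ω) ∂P :=
          lintegral_congr fun ω => by rw [hconst]; ring
      _ = _ := ih hW
      _ = _ := lintegral_congr fun ω => by ring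

end Network.IsModel

theorem Tier.kind_injective : Function.Injective Tier.kind := by
  rintro (_ | _) (_ | _) h <;> first | rfl | cases h

theorem volume_real_norm_lt_and_le {ρ d : ℝ} (hρ : 0 ≤ ρ) (hd : 0 ≤ d) :
    volume.real {x : Plane | ‖x‖ < ρ ∧ ‖x‖ ≤ d} = Real.pi * min ρ d ^ 2 := by
  rcases le_or_gt ρ d with h | h
  · have : {x : Plane | ‖x‖ < ρ ∧ ‖x‖ ≤ d} = Metric.ball 0 ρ := by
      ext x; simp only [mem_ofPred_eq, mem_ball_zero_iff]
      exact ⟨fun h => h.1, fun hx => ⟨hx, hx.le.trans h⟩⟩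
    rw [this, Measure.real, EuclideanSpace.volume_ball_fin_two, min_eq_left h, ENNReal.toReal_mul,
      ENNReal.toReal_pow, ENNReal.toReal_ofReal hρ, ENNReal.toReal_ofReal Real.pi_pos.le, mul_comm]
  · have : {x : Plane | ‖x‖ < ρ ∧ ‖x‖ ≤ d} = Metric.closedBall 0 d := by
      ext x; simp only [mem_ofPred_eq, mem_closedBall_zero_iff]
      exact ⟨fun h => h.2, fun hx => ⟨hx.trans_lt h, hx⟩⟩
    rw [this, Measure.real, EuclideanSpace.volume_closedBall_fin_two, min_eq_right h.le,
      ENNReal.toReal_mul, ENNReal.toReal_pow, ENNReal.toReal_ofReal hd,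
      ENNReal.toReal_ofReal Real.pi_pos.le, mul_comm]

/-- No polar coordinates are needed: the integrand is a combination of indicators of discs. -/
theorem Params.integral_one_sub_allowedProb (p : Params) {r : Los → ℝ} (hr : ∀ a, 0 ≤ r a) :
    ∫ x : Plane, (1 - p.allowedProb r ‖x‖)
      = Real.pi * (p.pLos * min (r .l) p.dLos ^ 2)
        + Real.pi * (r .n ^ 2 - p.pLos * min (r .n) p.dLos ^ 2) := by
  have hmeas (ρ d : ℝ) : MeasurableSet {x : Plane | ‖x‖ < ρ ∧ ‖x‖ ≤ d} :=
    (measurableSet_lt measurable_norm measurable_const).inter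
      (measurableSet_le measurable_norm measurable_const)
  have hfin (ρ d : ℝ) : volume {x : Plane | ‖x‖ < ρ ∧ ‖x‖ ≤ d} ≠ ∞ := by
    refine ((Metric.isBounded_ball (x := (0 : Plane)) (r := ρ)).subset ?_).measure_lt_top.ne
    exact fun x hx => mem_ball_zero_iff.2 hx.1
  have hint (ρ d c : ℝ) :
      Integrable ({x : Plane | ‖x‖ < ρ ∧ ‖x‖ ≤ d}.indicator fun _ => c) volume :=
    (integrable_indicator_iff (hmeas ρ d)).2 (integrableOn_const (hfin ρ d))
  -- The second set carries a redundant condition so that all three have the shape of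
  -- `volume_real_norm_lt_and_le`.
  have hpt (x : Plane) : 1 - p.allowedProb r ‖x‖
      = {x : Plane | ‖x‖ < r .l ∧ ‖x‖ ≤ p.dLos}.indicator (fun _ => p.pLos) x
        + ({x : Plane | ‖x‖ < r .n ∧ ‖x‖ ≤ r .n}.indicator (fun _ => 1) x
          - {x : Plane | ‖x‖ < r .n ∧ ‖x‖ ≤ p.dLos}.indicator (fun _ => p.pLos) x) := by
    simp only [allowedProb, losProb, Set.indicator, mem_ofPred_eq]
    by_cases h1 : r .l ≤ ‖x‖ <;> by_cases h2 : r .n ≤ ‖x‖ <;> by_cases h3 : ‖x‖ ≤ p.dLos <;>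
      simp [h1, h2, h3, not_lt.2, not_le.1, le_of_lt]
  simp_rw [hpt]
  refine (integral_add (hint _ _ _) ((hint _ _ _).sub (hint _ _ _))).trans ?_
  simp only [Pi.sub_apply]
  rw [integral_sub (hint _ _ _)
    (hint _ _ _), integral_indicator_const _ (hmeas _ _), integral_indicator_const _ (hmeas _ _),
    integral_indicator_const _ (hmeas _ _), volume_real_norm_lt_and_le (hr _) p.dLos_nonneg,
    volume_real_norm_lt_and_le (hr _) (hr _), volume_real_norm_lt_and_le (hr _) p.dLos_nonneg,
    min_self]
  simp only [smul_eq_mul]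
  ring

theorem Params.continuous_voidProb (p : Params) (t : Tier) (a : Los) :
    Continuous (p.voidProb t a) := by
  cases a
  · change Continuous fun R => Real.exp (-Real.pi * p.lam t.kind * (p.pLos * min R p.dLos ^ 2))
    fun_prop
  · change Continuous fun R =>
      Real.exp (-Real.pi * p.lam t.kind * (R ^ 2 - p.pLos * min R p.dLos ^ 2))
    fun_prop

theorem Params.voidProb_zero (p : Params) (t : Tier) (a : Los) : p.voidProb t a 0 = 1 := by
  cases a <;> simp [voidProb, p.dLos_nonneg]

theorem Params.voidProb_pos (p : Params) (t : Tier) (a : Los) (r : ℝ) : 0 < p.voidProb t a r := by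
  cases a <;> exact Real.exp_pos _

/-! ### Nearest distances of the four types: void probabilities and independence -/

namespace Network

variable {Ω : Type*}

/-- Distance from the origin to the nearest base station of given tier and link state. -/
def nearest (N : Network Ω) (p : Params) (q : Tier × Los) (ω : Ω) : ℝ≥0∞ :=
  ⨅ k : ℕ, ⨅ _ : N.los p (.bs (q.1, k)) .typ ω = q.2, ENNReal.ofReal ‖N.pos (.bs (q.1, k)) ω‖

theorem ofReal_le_nearest_iff (N : Network Ω) (p : Params) (q : Tier × Los) (ω : Ω) (r : ℝ) :
    ENNReal.ofReal r ≤ N.nearest p q ω ↔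
      ∀ k, N.los p (.bs (q.1, k)) .typ ω = q.2 → r ≤ ‖N.pos (.bs (q.1, k)) ω‖ := by
  simp only [nearest, le_iInf_iff, ENNReal.ofReal_le_ofReal_iff (norm_nonneg _)]

variable [MeasurableSpace Ω] {P : Measure Ω} [IsProbabilityMeasure P] {p : Params} {N : Network Ω}

theorem GeometryMeasurable.nearest {Ω : Type*} [MeasurableSpace Ω] {N : Network Ω}
    (h : N.GeometryMeasurable) (p : Params) (q : Tier × Los) :
    Measurable (N.nearest p q) := by
  classical
  refine Measurable.iInf fun k => ?_
  have : (fun ω => ⨅ _ : N.los p (.bs (q.1, k)) .typ ω = q.2,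
      ENNReal.ofReal ‖N.pos (.bs (q.1, k)) ω‖) = fun ω =>
      if N.los p (.bs (q.1, k)) .typ ω = q.2 then ENNReal.ofReal ‖N.pos (.bs (q.1, k)) ω‖
      else ⊤ := by
    ext ω; split_ifs with h <;> simp [h]
  rw [this]
  exact Measurable.ite (measurableSet_eq_fun (h.los p _ _) measurable_const)
    (h.pos _).norm.ennreal_ofReal measurable_const

namespace IsModel

/-- For the first `n` stations of each tier, thinning replaces the blockage by the factors
`allowedProb`, and independence of the tiers splits the expectation. As `n` grows, the generating
functional of each tier gives an exponential, which is a product of the void probabilities of the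
two link states. -/
theorem measure_void (hN : N.IsModel p P) {r : Tier → Los → ℝ} (hr : ∀ t a, 0 ≤ r t a) :
    P {ω | ∀ b : BS, r b.1 (N.los p (.bs b) .typ ω) ≤ ‖N.pos (.bs b) ω‖}
      = ∏ t, ∏ a, ENNReal.ofReal (p.voidProb t a (r t a)) := by
  classical
  let E : BS → Set Ω := fun b => {ω | r b.1 (N.los p (.bs b) .typ ω) ≤ ‖N.pos (.bs b) ω‖}
  let J : ℕ → Finset BS := fun n => Finset.univ ×ˢ Finset.range n
  have hEmem (b : BS) (ω : Ω) :
      ω ∈ E b ↔ (N.pos (.bs b) ω, N.blockage s(.bs b, .typ) ω) ∈ p.allowed (r b.1) := by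
    simp [E, Params.allowed, Network.los, Network.pos, dist_zero_right]
  have hE (b : BS) : MeasurableSet (E b) := by
    have h := hN.geometryMeasurable
    have : E b = (fun ω => (N.pos (.bs b) ω, N.blockage s(.bs b, .typ) ω)) ⁻¹' p.allowed (r b.1) :=
      Set.ext (hEmem b)
    rw [this]
    exact ((h.pos _).prodMk (h.blockage _)) (p.measurableSet_allowed _)
  have hlim1 : Tendsto (fun n => P (⋂ b ∈ J n, E b)) atTop (𝓝 (P (⋂ n, ⋂ b ∈ J n, E b))) := by
    refine tendsto_measure_iInter_atTop
      (fun n => (Finset.measurableSet_biInter _ fun b _ => hE b).nullMeasurableSet) ?_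
      ⟨0, measure_ne_top _ _⟩
    intro m n hmn
    exact biInter_subset_biInter_left fun b hb => by
      have := Finset.mem_range.1 (Finset.mem_product.1 hb).2
      exact Finset.mem_product.2 ⟨Finset.mem_univ _, Finset.mem_range.2 (this.trans_le hmn)⟩
  have hset : (⋂ n, ⋂ b ∈ J n, E b)
      = {ω | ∀ b : BS, r b.1 (N.los p (.bs b) .typ ω) ≤ ‖N.pos (.bs b) ω‖} := by
    ext ω
    simp only [mem_iInter, J, Finset.mem_product, Finset.mem_univ, true_and, Finset.mem_range]
    exact ⟨fun h b => h (b.2 + 1) b (Nat.lt_succ_self _), fun h n b _ => h b⟩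
  rw [hset] at hlim1
  refine tendsto_nhds_unique hlim1 ?_
  have hn (n : ℕ) : P (⋂ b ∈ J n, E b) = ∏ t : Tier, ∫⁻ ω, ∏ k ∈ Finset.range n,
      (((p.allowedProb (r t) ‖N.point t.kind k ω‖).toNNReal : ℝ≥0) : ℝ≥0∞) ∂P := by
    have h1 := hN.lintegral_mul_prod_indicator_allowed r (J n) (Z := fun _ => 1) measurable_const
    simp only [one_mul] at h1
    have h2 : P (⋂ b ∈ J n, E b) = ∫⁻ ω, ∏ b ∈ J n, (p.allowed (r b.1)).indicator 1
        (N.pos (.bs b) ω, N.blockage s(.bs b, .typ) ω) ∂P := by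
      rw [← lintegral_indicator_one (Finset.measurableSet_biInter _ fun b _ => hE b)]
      refine lintegral_congr fun ω => ?_
      by_cases hω : ω ∈ ⋂ b ∈ J n, E b
      · rw [Set.indicator_of_mem hω, Finset.prod_eq_one]
        · rfl
        · intro b hb
          rw [Set.indicator_of_mem ((hEmem b ω).1 (mem_iInter₂.1 hω b hb))]; rfl
      · rw [Set.indicator_of_notMem hω]
        simp only [mem_iInter, not_forall] at hω
        obtain ⟨b, hb, hbω⟩ := hω
        exact (Finset.prod_eq_zero hb (Set.indicator_of_notMem (mt (hEmem b ω).2 hbω) _)).symm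
    have hind := ((hN.indep 0).precomp (g := fun t : Tier => Source.point t.kind)
      fun t t' htt' => Tier.kind_injective (by simpa using htt')).comp
      (fun t (x : ℕ → Plane) => ∏ k ∈ Finset.range n,
        (((p.allowedProb (r t) ‖x k‖).toNNReal : ℝ≥0) : ℝ≥0∞)) fun t =>
        Finset.measurable_prod _ fun k _ => ((p.measurable_allowedProb _).comp
          (measurable_pi_apply k).norm).real_toNNReal.coe_nnreal_ennreal
    have h3 := lintegral_prod_eq_prod_lintegral_of_indepFun Finset.univ _ hind fun t =>
      (Finset.measurable_prod _ fun k _ => ((p.measurable_allowedProb _).comp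
          (measurable_pi_apply k).norm).real_toNNReal.coe_nnreal_ennreal).comp
            (hN.measurable 0 (.point t.kind))
    rw [h2, h1]
    refine Eq.trans (lintegral_congr fun ω => ?_) h3
    rw [Finset.prod_product]
    rfl
  simp_rw [hn]
  refine ENNReal.tendsto_finsetProd_of_ne_top _ (fun t _ => ?_) fun t _ => ?_
  · have hlaw := (hN.point t.kind).tendsto_lintegral_prod (p.lam_pos t.kind).le
      (w := fun x => (p.allowedProb (r t) ‖x‖).toNNReal)
      ((p.measurable_allowedProb _).comp measurable_norm).real_toNNReal
      (fun x => Real.toNNReal_le_one.2 (p.allowedProb_mem _ _).2) ?_ ?_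
    · convert hlaw using 2
      simp_rw [Real.coe_toNNReal _ (p.allowedProb_mem _ _).1]
      rw [p.integral_one_sub_allowedProb (hr t)]
      have huniv : (Finset.univ : Finset Los) = {.l, .n} := rfl
      rw [huniv, Finset.prod_pair (by simp), ← ENNReal.ofReal_mul (p.voidProb_pos _ _ _).le]
      simp only [Params.voidProb]
      rw [← Real.exp_add]
      congr 2; ring
    -- These are the values `allowedProb` can take, up to simplification; the generating functional
    -- is available for finitely many values.
    · refine (Set.Finite.image Real.toNNReal (s := {0, p.pLos, 1, 1 - p.pLos, 1 - 0, p.pLos + (1 - p.pLos), 0 + (1 - 0)})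
        (by simp)).subset ?_
      rintro _ ⟨x, rfl⟩
      refine ⟨_, ?_, rfl⟩
      simp only [Params.allowedProb, Params.losProb]
      split_ifs <;> simp
    · refine (Metric.isBounded_ball (x := (0 : Plane)) (r := max (r t .l) (r t .n))).subset ?_
      intro x hx
      by_contra h
      rw [mem_ball_zero_iff, not_lt, max_le_iff] at h
      refine hx ?_
      simp [Params.allowedProb, h.1, h.2]
  · exact ENNReal.prod_ne_top fun a _ => ENNReal.ofReal_ne_top

/-- Radius `0` imposes no condition and has void probability one, so the types outside `s` are given
radius `0` in `measure_void`. -/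
theorem measure_iInter_le_nearest (hN : N.IsModel p P) (s : Finset (Tier × Los))
    {r : Tier × Los → ℝ} (hr : ∀ q, 0 ≤ r q) :
    P (⋂ q ∈ s, {ω | ENNReal.ofReal (r q) ≤ N.nearest p q ω})
      = ∏ q ∈ s, ENNReal.ofReal (p.voidProb q.1 q.2 (r q)) := by
  classical
  have h := hN.measure_void (r := fun t a => if (t, a) ∈ s then r (t, a) else 0)
    fun t a => by split_ifs <;> simp [hr]
  rw [← Fintype.prod_prod_type' (f := fun t a => ENNReal.ofReal
    (p.voidProb t a (if (t, a) ∈ s then r (t, a) else 0)))] at h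
  rw [← Finset.prod_subset (Finset.subset_univ s) fun q _ hq => by
    simp [hq, p.voidProb_zero]] at h
  rw [Finset.prod_congr rfl (g := fun q => ENNReal.ofReal (p.voidProb q.1 q.2 (r q)))
    fun q hq => by simp [hq]] at h
  rw [← h]
  congr 1
  ext ω
  simp only [mem_iInter, mem_ofPred_eq, ofReal_le_nearest_iff]
  constructor
  · intro h b
    split_ifs with hb
    · exact h _ hb b.2 rfl
    · exact norm_nonneg _
  · rintro h ⟨t, a⟩ hq k hk
    have hk' : N.los p (.bs (t, k)) .typ ω = a := hk
    simpa [hk', hq] using h (t, k)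

theorem measure_le_nearest (hN : N.IsModel p P) (q : Tier × Los) {r : ℝ} (hr : 0 ≤ r) :
    P {ω | ENNReal.ofReal r ≤ N.nearest p q ω} = ENNReal.ofReal (p.voidProb q.1 q.2 r) := by
  simpa using hN.measure_iInter_le_nearest {q} (r := fun _ => r) fun _ => hr

/-- The strict event is the increasing union of the events with radius `r + 1/(n+1)`, and the void
probability is continuous. Agreement with the non-strict case is what disposes of ties. -/
theorem measure_lt_nearest (hN : N.IsModel p P) (q : Tier × Los) {r : ℝ} (hr : 0 ≤ r) :
    P {ω | ENNReal.ofReal r < N.nearest p q ω} = ENNReal.ofReal (p.voidProb q.1 q.2 r) := by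
  have hset : {ω | ENNReal.ofReal r < N.nearest p q ω}
      = ⋃ n : ℕ, {ω | ENNReal.ofReal (r + 1 / ((n : ℝ) + 1)) ≤ N.nearest p q ω} := by
    ext ω
    simp only [mem_ofPred_eq, mem_iUnion]
    constructor
    · intro h
      obtain ⟨x, hx, hx'⟩ := ENNReal.lt_iff_exists_real_btwn.1 h
      have hrx : r < x := (ENNReal.ofReal_lt_ofReal_iff_of_nonneg hr).1 hx'.1
      obtain ⟨n, hn⟩ := exists_nat_one_div_lt (sub_pos.2 hrx)
      exact ⟨n, (ENNReal.ofReal_le_ofReal (by linarith)).trans hx'.2.le⟩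
    · rintro ⟨n, hn⟩
      have : 0 < 1 / ((n : ℝ) + 1) := by positivity
      exact ((ENNReal.ofReal_lt_ofReal_iff_of_nonneg hr).2 (by linarith)).trans_le hn
  have hmono : Monotone fun n : ℕ =>
      {ω | ENNReal.ofReal (r + 1 / ((n : ℝ) + 1)) ≤ N.nearest p q ω} := by
    intro m n hmn ω hω
    refine (ENNReal.ofReal_le_ofReal ?_).trans hω
    have := Nat.one_div_le_one_div (α := ℝ) hmn
    linarith
  rw [hset]
  refine tendsto_nhds_unique (tendsto_measure_iUnion_atTop hmono) ?_
  have hlim : Tendsto (fun n : ℕ => r + 1 / ((n : ℝ) + 1)) atTop (𝓝 r) := by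
    simpa using tendsto_one_div_add_atTop_nhds_zero_nat.const_add r
  refine (ENNReal.tendsto_ofReal (((p.continuous_voidProb q.1 q.2).tendsto r).comp hlim)).congr
    fun n => ?_
  exact (hN.measure_le_nearest q (by positivity)).symm

/-- The ray at `∞` is a countable intersection of rays at finite points, so void events alone
generate the σ-algebra of a nearest distance. -/
theorem _root_.MmWave.borel_ennreal_eq_generateFrom_Ici_ofReal :
    (inferInstance : MeasurableSpace ℝ≥0∞)
      = MeasurableSpace.generateFrom {s | ∃ r : ℝ, 0 ≤ r ∧ s = Ici (ENNReal.ofReal r)} := by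
  refine le_antisymm ?_ ?_
  · rw [BorelSpace.measurable_eq (α := ℝ≥0∞), borel_eq_generateFrom_Ici]
    refine MeasurableSpace.generateFrom_le ?_
    rintro _ ⟨x, rfl⟩
    let _ := MeasurableSpace.generateFrom {s | ∃ r : ℝ, 0 ≤ r ∧ s = Ici (ENNReal.ofReal r)}
    have hr (r : ℝ) (h : 0 ≤ r) : MeasurableSet (Ici (ENNReal.ofReal r)) :=
      MeasurableSpace.measurableSet_generateFrom ⟨r, h, rfl⟩
    rcases eq_or_ne x ⊤ with rfl | hx
    · have : Ici (⊤ : ℝ≥0∞) = ⋂ n : ℕ, Ici (ENNReal.ofReal n) := by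
        ext y
        simp only [mem_Ici, top_le_iff, mem_iInter, ENNReal.ofReal_natCast]
        exact ⟨fun h => by simp [h], fun h => ENNReal.eq_top_of_forall_nnreal_le fun r => by
          obtain ⟨n, hn⟩ := exists_nat_ge r
          exact le_trans (by exact_mod_cast hn) (h n)⟩
      rw [this]
      exact MeasurableSet.iInter fun n => hr n n.cast_nonneg
    · rw [← ENNReal.ofReal_toReal hx]
      exact hr _ ENNReal.toReal_nonneg
  · refine MeasurableSpace.generateFrom_le ?_
    rintro _ ⟨r, _, rfl⟩
    exact measurableSet_Ici

/-- The tail events form a π-system that generates, and on them the probability factorizes by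
`measure_iInter_le_nearest`. -/
theorem iIndepFun_nearest (hN : N.IsModel p P) : iIndepFun (N.nearest p) P := by
  rw [iIndepFun_iff_iIndep]
  refine iIndepSets.iIndep (fun q => (hN.geometryMeasurable.nearest p q).comap_le)
    (fun q => {s | ∃ r : ℝ, 0 ≤ r ∧ s = {ω | ENNReal.ofReal r ≤ N.nearest p q ω}}) ?_ ?_ ?_
  · rintro q _ ⟨r, hr, rfl⟩ _ ⟨r', _, rfl⟩ _
    refine ⟨max r r', hr.trans (le_max_left _ _), ?_⟩
    ext ω
    simp [ENNReal.ofReal_max]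
  · intro q
    have := congrArg (MeasurableSpace.comap (N.nearest p q))
      borel_ennreal_eq_generateFrom_Ici_ofReal
    rw [MeasurableSpace.comap_generateFrom] at this
    refine this.trans ?_
    congr 1
    ext s
    constructor
    · rintro ⟨_, ⟨r, hr, rfl⟩, rfl⟩; exact ⟨r, hr, rfl⟩
    · rintro ⟨r, hr, rfl⟩; exact ⟨_, ⟨r, hr, rfl⟩, rfl⟩
  · rw [iIndepSets_iff]
    intro s f hf
    choose! r hr hf using hf
    -- The radii are known to be nonnegative only for `q ∈ s`; absolute values extend this to all
    -- types without changing the event.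
    have h := hN.measure_iInter_le_nearest s (r := fun q => |r q|) fun q => abs_nonneg _
    rw [iInter₂_congr hf, Finset.prod_congr rfl fun q hq => congrArg P (hf q hq)]
    rw [Finset.prod_congr rfl fun q hq => hN.measure_le_nearest q (hr q hq)]
    rw [Finset.prod_congr rfl (g := fun q => ENNReal.ofReal (p.voidProb q.1 q.2 (r q)))
      fun q hq => by rw [abs_of_nonneg (hr q hq)]] at h
    rw [← h]
    congr 1
    exact iInter₂_congr fun q hq => by rw [abs_of_nonneg (hr q hq)]

end IsModel

end Network

/-! ### Densities of the nearest distances -/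

theorem Params.nearestDensity_nonneg (p : Params) (t : Tier) (a : Los) {R : ℝ} (hR : 0 ≤ R) :
    0 ≤ p.nearestDensity t a R := by
  have h1 := (p.lam_pos t.kind).le
  have h2 := p.pLos_mem
  rw [mem_Icc] at h2
  have h3 : 0 ≤ 2 * Real.pi * p.lam t.kind * R := by positivity
  cases a <;> simp only [nearestDensity] <;>
    refine mul_nonneg (mul_nonneg h3 ?_) (Real.exp_pos _).le <;> split_ifs <;> linarith

theorem Params.measurable_nearestDensity (p : Params) (t : Tier) (a : Los) :
    Measurable (p.nearestDensity t a) := by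
  have h : Measurable fun R : ℝ => if R ≤ p.dLos then (1 : ℝ) else 0 :=
    Measurable.ite measurableSet_Iic measurable_const measurable_const
  cases a
  · change Measurable fun R : ℝ => 2 * Real.pi * p.lam t.kind * R
      * (p.pLos * (if R ≤ p.dLos then 1 else 0))
      * Real.exp (-Real.pi * p.lam t.kind * p.pLos * min R p.dLos ^ 2)
    fun_prop
  · change Measurable fun R : ℝ => 2 * Real.pi * p.lam t.kind * R
      * (1 - p.pLos * (if R ≤ p.dLos then 1 else 0))
      * Real.exp (-Real.pi * p.lam t.kind * (R ^ 2 - p.pLos * min R p.dLos ^ 2))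
    fun_prop

theorem Params.nearestDensity_eq (p : Params) (t : Tier) (a : Los) (R : ℝ) :
    p.nearestDensity t a R = 2 * Real.pi * p.lam t.kind * R
      * (match a with
        | .l => p.pLos * (if R ≤ p.dLos then 1 else 0)
        | .n => 1 - p.pLos * (if R ≤ p.dLos then 1 else 0)) * p.voidProb t a R := by
  cases a
  · simp only [nearestDensity, voidProb]; congr 2; ring
  · simp only [nearestDensity, voidProb]

/-- The LOS radius is excluded because `min R d_LOS` has a kink there; one exceptional point is
harmless for the fundamental theorem of calculus. -/
theorem Params.hasDerivAt_voidProb (p : Params) (t : Tier) (a : Los) {R : ℝ} (hR : R ≠ p.dLos) :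
    HasDerivAt (p.voidProb t a) (-p.nearestDensity t a R) R := by
  have hmin : HasDerivAt (fun R => min R p.dLos ^ 2)
      (2 * R * (if R ≤ p.dLos then 1 else 0)) R := by
    rcases lt_or_gt_of_ne hR with h | h
    · rw [if_pos h.le, mul_one]
      have h2 : HasDerivAt (fun R : ℝ => R ^ 2) (2 * R) R := by simpa using hasDerivAt_pow 2 R
      refine h2.congr_of_eventuallyEq ?_
      filter_upwards [eventually_lt_nhds h] with x hx
      rw [min_eq_left hx.le]
    · rw [if_neg (not_le.2 h), mul_zero]
      refine (hasDerivAt_const R (p.dLos ^ 2)).congr_of_eventuallyEq ?_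
      filter_upwards [eventually_gt_nhds h] with x hx
      rw [min_eq_right hx.le]
  have hsq : HasDerivAt (fun R : ℝ => R ^ 2) (2 * R) R := by simpa using hasDerivAt_pow 2 R
  rw [p.nearestDensity_eq]
  cases a
  · change HasDerivAt
      (fun R => Real.exp (-Real.pi * p.lam t.kind * (p.pLos * min R p.dLos ^ 2))) _ R
    convert ((hmin.const_mul p.pLos).const_mul (-Real.pi * p.lam t.kind)).exp using 1
    simp only [voidProb]; ring
  · change HasDerivAt
      (fun R => Real.exp (-Real.pi * p.lam t.kind * (R ^ 2 - p.pLos * min R p.dLos ^ 2))) _ R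
    convert ((hsq.fun_sub (hmin.const_mul p.pLos)).const_mul (-Real.pi * p.lam t.kind)).exp using 1
    simp only [voidProb]; ring

theorem Params.voidProb_le_one (p : Params) (t : Tier) (a : Los) {R : ℝ} (hR : 0 ≤ R) :
    p.voidProb t a R ≤ 1 := by
  have h1 := (p.lam_pos t.kind).le
  obtain ⟨h2, h3⟩ := p.pLos_mem
  have h4 : min R p.dLos ^ 2 ≤ R ^ 2 :=
    pow_le_pow_left₀ (le_min hR p.dLos_nonneg) (min_le_left _ _) 2
  have h5 : 0 ≤ Real.pi * p.lam t.kind := by positivity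
  cases a <;> simp only [voidProb] <;> refine Real.exp_le_one_iff.2 ?_
  · have : 0 ≤ Real.pi * p.lam t.kind * (p.pLos * min R p.dLos ^ 2) := by positivity
    linarith
  · have : 0 ≤ Real.pi * p.lam t.kind * (R ^ 2 - p.pLos * min R p.dLos ^ 2) :=
      mul_nonneg h5 (by nlinarith [sq_nonneg (min R p.dLos)])
    linarith

theorem Params.lintegral_nearestDensity (p : Params) (t : Tier) (a : Los) {r : ℝ} (hr : 0 ≤ r) :
    ∫⁻ R in Ioc 0 r, ENNReal.ofReal (p.nearestDensity t a R)
      = ENNReal.ofReal (1 - p.voidProb t a r) := by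
  have hint : IntegrableOn (p.nearestDensity t a) (Ioc 0 r) := by
    refine Integrable.mono' (g := fun R => 2 * Real.pi * p.lam t.kind * R)
      ((Continuous.integrableOn_Icc (by fun_prop)).mono_set Ioc_subset_Icc_self)
      (p.measurable_nearestDensity t a).aestronglyMeasurable ?_
    filter_upwards [ae_restrict_mem measurableSet_Ioc] with R hR
    rw [Real.norm_of_nonneg (p.nearestDensity_nonneg t a hR.1.le), p.nearestDensity_eq]
    have h1 := (p.lam_pos t.kind).le
    have h0 : 0 ≤ 2 * Real.pi * p.lam t.kind * R := by have := hR.1.le; positivity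
    have h2 := p.pLos_mem
    rw [mem_Icc] at h2
    refine mul_le_of_le_one_right h0 ?_ |> (mul_assoc _ _ _).trans_le
    refine mul_le_one₀ ?_ (p.voidProb_pos t a R).le (p.voidProb_le_one t a hR.1.le)
    cases a <;> simp only <;> split_ifs <;> linarith
  rw [← ofReal_integral_eq_lintegral_ofReal hint
    ((ae_restrict_mem measurableSet_Ioc).mono fun R hR => p.nearestDensity_nonneg t a hR.1.le),
    ← intervalIntegral.integral_of_le hr]
  have h := integral_eq_of_hasDerivAt_off_countable (p.voidProb t a)
    (fun R => -p.nearestDensity t a R) (a := 0) (b := r) (countable_singleton p.dLos)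
    (p.continuous_voidProb t a).continuousOn (fun x hx => p.hasDerivAt_voidProb t a hx.2)
    ((intervalIntegrable_iff_integrableOn_Ioc_of_le hr).2 hint.neg)
  rw [intervalIntegral.integral_neg, p.voidProb_zero] at h
  congr 1; linarith

/-- Radius around the origin which is free of base stations of tier and state `q` if a base station
of tier and state `q₀` at distance `R` is preferred to all of them. -/
def Params.exclusionRadius (p : Params) (q₀ q : Tier × Los) (R : ℝ) : ℝ :=
  (p.pow q.1.kind * p.mainGain q.1.kind * p.bias q.1 * R ^ p.alpha q₀.2
    / (p.pow q₀.1.kind * p.bias q₀.1 * p.mainGain q₀.1.kind)) ^ (1 / p.alpha q.2)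

/-- Density of the distance to the serving base station on the event that it is of tier and state
`q`. -/
def Params.servingDensity (p : Params) (q : Tier × Los) (R : ℝ) : ℝ :=
  (∏ q' ∈ (Finset.univ : Finset (Tier × Los)).erase q,
    p.voidProb q'.1 q'.2 (p.exclusionRadius q q' R)) * p.nearestDensity q.1 q.2 R

/-- Biased equivalent isotropic power of a tier. -/
def Params.weight (p : Params) (t : Tier) : ℝ := p.pow t.kind * p.mainGain t.kind * p.bias t

theorem Params.weight_pos (p : Params) (t : Tier) : 0 < p.weight t :=
  mul_pos (mul_pos (p.pow_pos _) (p.mainGain_pos _)) (p.bias_pos _)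

theorem Params.exclusionRadius_eq (p : Params) (q₀ q : Tier × Los) (R : ℝ) :
    p.exclusionRadius q₀ q R
      = (p.weight q.1 * R ^ p.alpha q₀.2 / p.weight q₀.1) ^ (p.alpha q.2)⁻¹ := by
  rw [exclusionRadius, weight, weight, one_div, mul_right_comm (p.pow q₀.1.kind)]

theorem Params.exclusionRadius_nonneg (p : Params) (q₀ q : Tier × Los) {R : ℝ} (hR : 0 ≤ R) :
    0 ≤ p.exclusionRadius q₀ q R := by
  have h1 := (p.weight_pos q.1).le
  have h2 := (p.weight_pos q₀.1).le
  rw [exclusionRadius_eq]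
  positivity

/-- The radius solves the equality of biased powers for the distance of the competitor. Both this
form and the strict one are needed, as ties may go either way. -/
theorem Params.exclusionRadius_le_iff (p : Params) (q₀ q : Tier × Los) {R d : ℝ} (hR : 0 < R)
    (hd : 0 < d) : p.exclusionRadius q₀ q R ≤ d ↔
      p.weight q.1 * (d ^ p.alpha q.2)⁻¹ ≤ p.weight q₀.1 * (R ^ p.alpha q₀.2)⁻¹ := by
  have h1 := p.weight_pos q.1
  have h2 := p.weight_pos q₀.1
  have h3 : 0 < R ^ p.alpha q₀.2 := Real.rpow_pos_of_pos hR _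
  have h4 : 0 < d ^ p.alpha q.2 := Real.rpow_pos_of_pos hd _
  rw [exclusionRadius_eq, Real.rpow_inv_le_iff_of_pos (by positivity) hd.le (p.alpha_pos _),
    div_le_iff₀ h2, ← div_eq_mul_inv, ← div_eq_mul_inv, div_le_div_iff₀ h4 h3,
    mul_comm (d ^ p.alpha q.2)]

theorem Params.exclusionRadius_lt_iff (p : Params) (q₀ q : Tier × Los) {R d : ℝ} (hR : 0 < R)
    (hd : 0 < d) : p.exclusionRadius q₀ q R < d ↔
      p.weight q.1 * (d ^ p.alpha q.2)⁻¹ < p.weight q₀.1 * (R ^ p.alpha q₀.2)⁻¹ := by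
  have h1 := p.weight_pos q.1
  have h2 := p.weight_pos q₀.1
  have h3 : 0 < R ^ p.alpha q₀.2 := Real.rpow_pos_of_pos hR _
  have h4 : 0 < d ^ p.alpha q.2 := Real.rpow_pos_of_pos hd _
  rw [exclusionRadius_eq, Real.rpow_inv_lt_iff_of_pos (by positivity) hd.le (p.alpha_pos _),
    div_lt_iff₀ h2, ← div_eq_mul_inv, ← div_eq_mul_inv, div_lt_div_iff₀ h4 h3,
    mul_comm (d ^ p.alpha q.2)]

theorem Params.exclusionRadius_self (p : Params) (q : Tier × Los) {R : ℝ} (hR : 0 ≤ R) :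
    p.exclusionRadius q q R = R := by
  rw [exclusionRadius_eq, mul_div_cancel_left₀ _ (p.weight_pos _).ne',
    Real.rpow_rpow_inv hR (p.alpha_pos _).ne']

theorem Params.measurable_exclusionRadius (p : Params) (q₀ q : Tier × Los) :
    Measurable (p.exclusionRadius q₀ q) := by
  unfold exclusionRadius
  fun_prop

/-! ### Law of the distance to the serving base station -/

namespace Network

variable {Ω : Type*}

theorem biasedPower_typ (N : Network Ω) (p : Params) (b : BS) (ω : Ω) :
    N.biasedPower p b .typ ω = p.weight b.1
      * (‖N.pos (.bs b) ω‖ ^ p.alpha (N.los p (.bs b) .typ ω))⁻¹ := by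
  simp only [biasedPower, pathLoss, Params.weight, pos, dist_zero_right]
  ring

variable [MeasurableSpace Ω] {P : Measure Ω} {p : Params} {N : Network Ω}

namespace IsModel

variable [IsProbabilityMeasure P]

/-- The distribution function is one minus the void probability. The restriction to finite values is
essential: line-of-sight stations lie in a bounded disc, so with positive probability a tier has
none and the density has mass below one. -/
theorem map_nearest (hN : N.IsModel p P) (q : Tier × Los) :
    (P.restrict {ω | N.nearest p q ω ≠ ∞}).map (fun ω => (N.nearest p q ω).toReal)
      = (volume.restrict (Ioi (0 : ℝ))).withDensity
          fun R => ENNReal.ofReal (p.nearestDensity q.1 q.2 R) := by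
  have hmeas := hN.geometryMeasurable.nearest p q
  have hfin : MeasurableSet {ω | N.nearest p q ω ≠ ∞} :=
    (hmeas (measurableSet_singleton ∞)).compl
  refine Measure.ext_of_Iic _ _ fun r => ?_
  rw [Measure.map_apply hmeas.ennreal_toReal measurableSet_Iic, Measure.restrict_apply'
    hfin, withDensity_apply _ measurableSet_Iic, Measure.restrict_restrict measurableSet_Iic,
    inter_comm (Iic r), Ioi_inter_Iic]
  rcases lt_or_ge r 0 with hr | hr
  · rw [Ioc_eq_empty (by linarith), Measure.restrict_empty, lintegral_zero_measure]
    convert measure_empty (μ := P)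
    ext ω
    simp only [mem_inter_iff, mem_preimage, mem_Iic, mem_empty_iff_false, iff_false]
    intro h
    have := (ENNReal.toReal_nonneg (a := N.nearest p q ω)).trans h.1
    linarith
  · rw [p.lintegral_nearestDensity _ _ hr]
    have hset : (fun ω => (N.nearest p q ω).toReal) ⁻¹' Iic r ∩ {ω | N.nearest p q ω ≠ ∞}
        = {ω | ENNReal.ofReal r < N.nearest p q ω}ᶜ := by
      ext ω
      simp only [mem_inter_iff, mem_preimage, mem_Iic, mem_ofPred_eq, mem_compl_iff, not_lt]
      constructor
      · rintro ⟨h1, h2⟩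
        exact (ENNReal.le_ofReal_iff_toReal_le h2 hr).2 h1
      · intro h
        have h2 : N.nearest p q ω ≠ ∞ := (h.trans_lt ENNReal.ofReal_lt_top).ne
        exact ⟨(ENNReal.le_ofReal_iff_toReal_le h2 hr).1 h, h2⟩
    rw [hset, prob_compl_eq_one_sub (measurableSet_lt measurable_const hmeas),
      hN.measure_lt_nearest q hr, ENNReal.ofReal_sub _ (p.voidProb_pos _ _ _).le,
      ENNReal.ofReal_one]

/-- The law of the distance to the nearest base station of a type on the event that the nearest base
stations of all other types satisfy constraints depending on this distance. -/
theorem measure_nearest_inter (hN : N.IsModel p P) (q : Tier × Los) {B : Set ℝ}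
    (hB : MeasurableSet B) (S : Tier × Los → ℝ → Set ℝ≥0∞)
    (hS : ∀ q', MeasurableSet {x : ℝ≥0∞ × ℝ | x.1 ∈ S q' x.2})
    (hP : ∀ q' R, 0 ≤ R → P {ω | N.nearest p q' ω ∈ S q' R}
      = ENNReal.ofReal (p.voidProb q'.1 q'.2 (p.exclusionRadius q q' R))) :
    P {ω | N.nearest p q ω ≠ ∞ ∧ (N.nearest p q ω).toReal ∈ B
        ∧ ∀ q' ≠ q, N.nearest p q' ω ∈ S q' (N.nearest p q ω).toReal}
      = ∫⁻ R in Ioi 0, B.indicator (fun R => ENNReal.ofReal (p.servingDensity q R)) R := by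
  classical
  have hmeas (q') := hN.geometryMeasurable.nearest p q'
  set T : Finset (Tier × Los) := Finset.univ.erase q with hT
  let U : Ω → (T → ℝ≥0∞) := fun ω q' => N.nearest p q' ω
  have hU : Measurable U := measurable_pi_lambda _ fun q' => hmeas q'
  have hind : Indep (MeasurableSpace.comap U inferInstance)
      (MeasurableSpace.comap (N.nearest p q) inferInstance) P := by
    have h := hN.iIndepFun_nearest.indepFun_finset T {q}
      (by simp [hT]) hmeas
    have hψ : Measurable fun x : ({q} : Finset (Tier × Los)) → ℝ≥0∞ =>
      x ⟨q, Finset.mem_singleton_self q⟩ := measurable_pi_apply _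
    exact h.comp measurable_id hψ
  let D : Set ((T → ℝ≥0∞) × ℝ≥0∞) :=
    {x | x.2 ≠ ∞ ∧ x.2.toReal ∈ B ∧ ∀ q' : T, x.1 q' ∈ S q' x.2.toReal}
  have hD : MeasurableSet D := by
    refine (measurable_snd (measurableSet_singleton ∞)).compl.inter
      ((measurable_snd.ennreal_toReal hB).inter ?_)
    change MeasurableSet {x : (T → ℝ≥0∞) × ℝ≥0∞ | ∀ q' : T, x.1 q' ∈ S q' x.2.toReal}
    rw [Set.ofPred_forall]
    refine MeasurableSet.iInter fun q' => ?_
    have hpair : Measurable fun x : (T → ℝ≥0∞) × ℝ≥0∞ => (x.1 q', x.2.toReal) :=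
      ((measurable_pi_apply q').comp measurable_fst).prodMk measurable_snd.ennreal_toReal
    exact hpair (hS q')
  have hset : {ω | N.nearest p q ω ≠ ∞ ∧ (N.nearest p q ω).toReal ∈ B
        ∧ ∀ q' ≠ q, N.nearest p q' ω ∈ S q' (N.nearest p q ω).toReal}
      = (fun ω => (U ω, N.nearest p q ω)) ⁻¹' D := by
    ext ω
    simp only [mem_ofPred_eq, mem_preimage, D, U, Subtype.forall, hT, Finset.mem_erase,
      Finset.mem_univ, and_true]
  rw [hset, ← lintegral_indicator_one ((hU.prodMk (hmeas q)) hD)]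
  -- The nearest distance of type `q` is frozen; the vector of the other three is independent of it.
  have key := lintegral_comp_prodMk_of_indep (hmeas q).comap_le hU hind
    (comap_measurable (N.nearest p q)) (f := D.indicator 1) (measurable_one.indicator hD)
  refine Eq.trans (by rfl) (key.trans ?_)
  -- At a frozen distance the constraints on the other types are independent, and their
  -- probabilities multiply.
  have hin (z : ℝ≥0∞) : ∫⁻ u, D.indicator (1 : (T → ℝ≥0∞) × ℝ≥0∞ → ℝ≥0∞) (u, z) ∂(P.map U)
      = {z : ℝ≥0∞ | z ≠ ∞}.indicator (fun z => B.indicator (fun R => ∏ q' ∈ T,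
        ENNReal.ofReal (p.voidProb q'.1 q'.2 (p.exclusionRadius q q' R))) z.toReal) z := by
    have h1 : ∫⁻ u, D.indicator (1 : (T → ℝ≥0∞) × ℝ≥0∞ → ℝ≥0∞) (u, z) ∂(P.map U) = P {ω | (U ω, z) ∈ D} := by
      refine (lintegral_indicator_one (measurable_prodMk_right hD)).trans ?_
      exact Measure.map_apply hU (measurable_prodMk_right hD)
    rw [h1]
    by_cases hz : z = ∞
    · rw [indicator_of_notMem (by simpa using hz)]
      simp [D, hz]
    rw [indicator_of_mem (show z ∈ {z : ℝ≥0∞ | z ≠ ∞} from hz)]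
    by_cases hzB : z.toReal ∈ B
    · rw [indicator_of_mem hzB]
      have h2 : {ω | (U ω, z) ∈ D} = ⋂ q' ∈ T, N.nearest p q' ⁻¹' S q' z.toReal := by
        ext ω
        simp only [D, U, mem_ofPred_eq, mem_iInter, mem_preimage, Subtype.forall]
        exact ⟨fun h => h.2.2, fun h => ⟨hz, hzB, h⟩⟩
      rw [h2]
      refine (hN.iIndepFun_nearest.measure_inter_preimage_eq_mul T
        (sets := fun q' => S q' z.toReal) fun q' _ => measurable_prodMk_right (hS q')).trans ?_
      exact Finset.prod_congr rfl fun q' _ => hP q' _ ENNReal.toReal_nonneg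
    · rw [indicator_of_notMem hzB]
      simp [D, hzB]
  simp_rw [hin]
  have hg : Measurable (B.indicator fun R => ∏ q' ∈ T,
        ENNReal.ofReal (p.voidProb q'.1 q'.2 (p.exclusionRadius q q' R))) :=
    (Finset.measurable_prod _ fun q' _ => ((p.continuous_voidProb _ _).measurable.comp
      (p.measurable_exclusionRadius q q')).ennreal_ofReal).indicator hB
  have hfin : MeasurableSet {ω | N.nearest p q ω ≠ ∞} :=
    (hmeas q (measurableSet_singleton ∞)).compl
  calc _ = ∫⁻ ω in {ω | N.nearest p q ω ≠ ∞}, B.indicator (fun R => ∏ q' ∈ T,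
        ENNReal.ofReal (p.voidProb q'.1 q'.2 (p.exclusionRadius q q' R)))
          (N.nearest p q ω).toReal ∂P := by
        rw [← lintegral_indicator hfin]; rfl
    _ = ∫⁻ R, B.indicator (fun R => ∏ q' ∈ T,
        ENNReal.ofReal (p.voidProb q'.1 q'.2 (p.exclusionRadius q q' R))) R
        ∂((P.restrict {ω | N.nearest p q ω ≠ ∞}).map (fun ω => (N.nearest p q ω).toReal)) :=
        (lintegral_map hg (hmeas q).ennreal_toReal).symm
    _ = _ := by
        rw [hN.map_nearest, lintegral_withDensity_eq_lintegral_mul _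
          (p.measurable_nearestDensity _ _).ennreal_ofReal hg]
        refine setLIntegral_congr_fun measurableSet_Ioi fun R hR => ?_
        by_cases hRB : R ∈ B
        · simp only [Pi.mul_apply, indicator_of_mem hRB]
          rw [Params.servingDensity, ENNReal.ofReal_mul
            (Finset.prod_nonneg fun _ _ => (p.voidProb_pos _ _ _).le), mul_comm,
            ENNReal.ofReal_prod_of_nonneg fun _ _ => (p.voidProb_pos _ _ _).le]
        · simp [indicator_of_notMem hRB]

/-- The typical configurations: no base station at the origin, and finitely many in bounded sets. -/
theorem ae_pos_and_finite (hN : N.IsModel p P) : ∀ᵐ ω ∂P, (∀ b : BS, 0 < ‖N.pos (.bs b) ω‖) ∧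
    ∀ (t : Tier) (r : ℝ), {k | ‖N.pos (.bs (t, k)) ω‖ ≤ r}.Finite := by
  have h1 (t : Tier) : ∀ᵐ ω ∂P, ∀ k, 0 < ‖N.pos (.bs (t, k)) ω‖ := by
    have h := (hN.point t.kind).poisson {0} (measurableSet_singleton _)
      Bornology.isBounded_singleton 0
    have hmeas := (hN.point t.kind).measurable_encard (measurableSet_singleton (0 : Plane))
    have h' : P {ω | {k | N.point t.kind k ω ∈ ({0} : Set Plane)}.encard = (0 : ℕ)} = 1 := by
      rw [h, poissonMeasure_singleton]; simp
    have h'' := (prob_compl_eq_zero_iff (hmeas (measurableSet_singleton _))).2 h'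
    filter_upwards [measure_eq_zero_iff_ae_notMem.1 h''] with ω hω k
    simp only [mem_compl_iff, mem_preimage, mem_singleton_iff, not_not, Nat.cast_zero,
      Set.encard_eq_zero] at hω
    refine norm_pos_iff.2 fun h0 => ?_
    have : k ∈ {k | N.point t.kind k ω = 0} := h0
    rw [hω] at this
    exact this
  have h2 (t : Tier) (n : ℕ) : ∀ᵐ ω ∂P, {k | ‖N.pos (.bs (t, k)) ω‖ ≤ n}.Finite := by
    have := (hN.point t.kind).ae_finite (A := Metric.closedBall 0 n)
      Metric.isClosed_closedBall.measurableSet Metric.isBounded_closedBall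
    filter_upwards [this] with ω hω
    simp only [mem_closedBall_zero_iff] at hω
    exact hω
  filter_upwards [ae_all_iff.2 h1, ae_all_iff.2 fun t => ae_all_iff.2 (h2 t)] with ω h1 h2
  refine ⟨fun b => h1 b.1 b.2, fun t r => ?_⟩
  obtain ⟨n, hn⟩ := exists_nat_ge r
  exact (h2 t n).subset fun k hk => le_trans hk hn

/-- An infimum of positive distances could still vanish; the void probability at radius `0` rules
this out. Comparing biased powers requires positive distances. -/
theorem ae_nearest_ne_zero (hN : N.IsModel p P) (q : Tier × Los) :
    ∀ᵐ ω ∂P, N.nearest p q ω ≠ 0 := by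
  have h := hN.measure_lt_nearest q le_rfl
  rw [p.voidProb_zero, ENNReal.ofReal_one, ENNReal.ofReal_zero] at h
  have h' := (prob_compl_eq_zero_iff (measurableSet_lt measurable_const
    (hN.geometryMeasurable.nearest p q))).2 h
  filter_upwards [measure_eq_zero_iff_ae_notMem.1 h'] with ω hω h0
  exact hω (by simp [h0])

/-- A maximizer exists because the stations at least as strong as a given one lie in a bounded
region and are therefore finitely many. So almost surely `server` does not return its default value.
-/
theorem ae_biasedPower_le_tagged (hN : N.IsModel p P) :
    ∀ᵐ ω ∂P, (∀ b : BS, 0 < ‖N.pos (.bs b) ω‖) ∧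
      ∀ b, N.biasedPower p b .typ ω ≤ N.biasedPower p (N.tagged p ω) .typ ω := by
  classical
  filter_upwards [hN.ae_pos_and_finite] with ω ⟨hpos, hfin⟩
  refine ⟨hpos, ?_⟩
  suffices h : ∃ b : BS, ∀ b' : BS, N.biasedPower p b' .typ ω ≤ N.biasedPower p b .typ ω by
    have hs : N.tagged p ω = Encodable.choose h := by
      unfold tagged server
      rw [dif_pos h]
    rw [hs]
    exact Encodable.choose_spec h
  let q (b : BS) : Tier × Los := (b.1, N.los p (.bs b) .typ ω)
  let b₀ : BS := (.m, 0)
  have hA : {b | N.biasedPower p b₀ .typ ω ≤ N.biasedPower p b .typ ω}.Finite := by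
    -- The sum of the exclusion radii over all types dominates each of them, hence works whatever
    -- the type of the competitor.
    let M : ℝ := ∑ a, ∑ t, p.exclusionRadius (q b₀) (t, a) ‖N.pos (.bs b₀) ω‖
    have hsub : {b | N.biasedPower p b₀ .typ ω ≤ N.biasedPower p b .typ ω}
        ⊆ ⋃ t : Tier, (Prod.mk t) '' {k | ‖N.pos (.bs (t, k)) ω‖ ≤ M} := by
      rintro ⟨t, k⟩ hb
      refine mem_iUnion.2 ⟨t, k, ?_, rfl⟩
      have hnn (t a) : 0 ≤ p.exclusionRadius (q b₀) (t, a) ‖N.pos (.bs b₀) ω‖ :=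
        p.exclusionRadius_nonneg _ _ (norm_nonneg _)
      have h1 : ‖N.pos (.bs (t, k)) ω‖
          ≤ p.exclusionRadius (q b₀) (q (t, k)) ‖N.pos (.bs b₀) ω‖ := by
        by_contra hlt
        rw [not_le] at hlt
        rw [p.exclusionRadius_lt_iff _ _ (hpos _) (hpos _)] at hlt
        refine absurd (show N.biasedPower p b₀ .typ ω ≤ N.biasedPower p (t, k) .typ ω from hb)
          (not_le.2 ?_)
        rw [N.biasedPower_typ, N.biasedPower_typ]
        exact hlt
      refine h1.trans ?_
      exact (Finset.single_le_sum (f := fun t => p.exclusionRadius (q b₀) (t, (q (_, k)).2)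
        ‖N.pos (.bs b₀) ω‖) (fun t _ => hnn t _) (Finset.mem_univ t)).trans
        (Finset.single_le_sum (f := fun a => ∑ t, p.exclusionRadius (q b₀) (t, a)
          ‖N.pos (.bs b₀) ω‖) (fun a _ => Finset.sum_nonneg fun t _ => hnn t a)
          (Finset.mem_univ _))
    exact (Set.finite_iUnion fun t => (hfin t M).image _).subset hsub
  obtain ⟨b, hbA, hb⟩ := hA.exists_maximalFor (fun b => N.biasedPower p b .typ ω) _ 
    ⟨b₀, show N.biasedPower p b₀ .typ ω ≤ N.biasedPower p b₀ .typ ω from le_rfl⟩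
  refine ⟨b, fun b' => ?_⟩
  by_contra h
  rw [not_le] at h
  exact absurd (hb (show b' ∈ {b | _} from le_trans hbA h.le) h.le) (not_le.2 h)

/-- The law of the distance to the serving base station on the event that it is of a given type. -/
theorem map_tagDist (hN : N.IsModel p P) (t : Tier) (a : Los) :
    (P.restrict (N.typeEvent p t a)).map (N.tagDist p)
      = (volume.restrict (Ioi (0 : ℝ))).withDensity
          fun R => ENNReal.ofReal (p.servingDensity (t, a) R) := by
  have hgeo := hN.geometryMeasurable
  refine Measure.ext fun B hB => ?_
  rw [Measure.map_apply (hgeo.tagDist p) hB, Measure.restrict_apply (hgeo.tagDist p hB),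
    withDensity_apply _ hB, ← lintegral_indicator hB]
  set q₀ : Tier × Los := (t, a)
  -- Deterministic part: a maximizer is the nearest station of its own type, and each type stays
  -- outside its exclusion radius.
  have hD (ω) (hω : (∀ b : BS, 0 < ‖N.pos (.bs b) ω‖) ∧
      ∀ b, N.biasedPower p b .typ ω ≤ N.biasedPower p (N.tagged p ω) .typ ω) :
      N.nearest p ((N.tagged p ω).1, N.tagLos p ω) ω = ENNReal.ofReal (N.tagDist p ω) ∧
      ∀ q, ENNReal.ofReal (p.exclusionRadius ((N.tagged p ω).1, N.tagLos p ω) q (N.tagDist p ω))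
        ≤ N.nearest p q ω := by
    have h2 (q) : ENNReal.ofReal
        (p.exclusionRadius ((N.tagged p ω).1, N.tagLos p ω) q (N.tagDist p ω))
        ≤ N.nearest p q ω := by
      rw [N.ofReal_le_nearest_iff]
      intro k hk
      have := hω.2 (q.1, k)
      rw [N.biasedPower_typ, N.biasedPower_typ, hk] at this
      exact (p.exclusionRadius_le_iff _ _ (hω.1 _) (hω.1 _)).2 this
    refine ⟨le_antisymm ?_ ?_, h2⟩
    · exact iInf_le_of_le (N.tagged p ω).2 (iInf_le_of_le rfl le_rfl)
    · simpa only [p.exclusionRadius_self _ (norm_nonneg _), tagDist] using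
        h2 ((N.tagged p ω).1, N.tagLos p ω)
  -- The event lies between strict and non-strict exclusion, up to null sets. Both have the same
  -- probability, so no separate proof is needed that ties are null.
  refine le_antisymm ?_ ?_
  · rw [← hN.measure_nearest_inter q₀ hB (fun q R => Ici (ENNReal.ofReal (p.exclusionRadius q₀ q R)))
      (fun q => measurableSet_le ((p.measurable_exclusionRadius q₀ q).comp
        measurable_snd).ennreal_ofReal measurable_fst)
      (fun q R hR => hN.measure_le_nearest q (p.exclusionRadius_nonneg q₀ q hR))]
    refine measure_mono_ae ?_
    filter_upwards [hN.ae_biasedPower_le_tagged] with ω hω ⟨hB', ht, ha⟩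
    obtain ⟨h1, h2⟩ := hD ω hω
    rw [ht, ha] at h1 h2
    have h3 : (N.nearest p q₀ ω).toReal = N.tagDist p ω := by
      rw [h1, ENNReal.toReal_ofReal (show 0 ≤ N.tagDist p ω from norm_nonneg _)]
    refine ⟨by rw [h1]; exact ENNReal.ofReal_ne_top, by rw [h3]; exact hB', fun q _ => ?_⟩
    rw [h3]
    exact h2 q
  · rw [← hN.measure_nearest_inter q₀ hB (fun q R => Ioi (ENNReal.ofReal (p.exclusionRadius q₀ q R)))
      (fun q => measurableSet_lt ((p.measurable_exclusionRadius q₀ q).comp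
        measurable_snd).ennreal_ofReal measurable_fst)
      (fun q R hR => hN.measure_lt_nearest q (p.exclusionRadius_nonneg q₀ q hR))]
    refine measure_mono_ae ?_
    filter_upwards [hN.ae_biasedPower_le_tagged, hN.ae_nearest_ne_zero q₀]
      with ω hω h0 ⟨hfin, hB', hq⟩
    obtain ⟨h1, h2⟩ := hD ω hω
    have hpos : 0 < N.tagDist p ω := hω.1 _
    -- If `X*` had another type, strict exclusion would make it weaker than the nearest station of
    -- type `q₀`, contrary to maximality.
    have htype : ((N.tagged p ω).1, N.tagLos p ω) = q₀ := by
      by_contra hne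
      have h3 := hq _ hne
      rw [mem_Ioi, h1, ENNReal.ofReal_lt_ofReal_iff hpos,
        p.exclusionRadius_lt_iff _ _ (ENNReal.toReal_pos h0 hfin) hpos] at h3
      have h4 := h2 q₀
      rw [ENNReal.ofReal_le_iff_le_toReal hfin,
        p.exclusionRadius_le_iff _ _ hpos (ENNReal.toReal_pos h0 hfin)] at h4
      exact absurd h3 (not_lt.2 h4)
    rw [htype] at h1
    have h3 : (N.nearest p q₀ ω).toReal = N.tagDist p ω := by
      rw [h1, ENNReal.toReal_ofReal (show 0 ≤ N.tagDist p ω from norm_nonneg _)]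
    refine ⟨?_, congrArg Prod.fst htype, congrArg Prod.snd htype⟩
    rw [h3] at hB'
    exact hB'

end IsModel

end Network

/-! ### Exponential fading and coverage on events of given frame and type -/

theorem expMeasure_one_lt_ofReal (z : ℝ≥0∞) :
    expMeasure 1 {h | z < ENNReal.ofReal h} = ENNReal.ofReal (Network.expNeg 1 z) := by
  have : IsProbabilityMeasure (expMeasure 1) := isProbabilityMeasure_expMeasure one_pos
  unfold Network.expNeg
  split_ifs with hz
  · simp [hz]
  · have hset : {h : ℝ | z < ENNReal.ofReal h} = (Iic z.toReal)ᶜ := by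
      ext h
      simp [ENNReal.lt_ofReal_iff_toReal_lt hz]
    rw [hset, ← ofReal_measureReal, measureReal_compl measurableSet_Iic, ← cdf_eq_real,
      cdf_expMeasure_eq one_pos, if_pos ENNReal.toReal_nonneg, probReal_univ]
    congr 1; ring_nf

namespace Network

theorem measurable_expNeg : Measurable fun q : ℝ × ℝ≥0∞ => expNeg q.1 q.2 :=
  Measurable.ite (measurable_snd (measurableSet_singleton ∞)) measurable_const
    ((measurable_fst.neg.mul measurable_snd.ennreal_toReal).exp)

theorem expNeg_nonneg (s : ℝ) (x : ℝ≥0∞) : 0 ≤ expNeg s x := by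
  unfold expNeg; split_ifs
  · exact le_rfl
  · exact (Real.exp_pos _).le

theorem expNeg_le_one {s : ℝ} (hs : 0 ≤ s) (x : ℝ≥0∞) : expNeg s x ≤ 1 := by
  unfold expNeg; split_ifs
  · exact zero_le_one
  · exact Real.exp_le_one_iff.2 (by
      have := mul_nonneg hs (ENNReal.toReal_nonneg (a := x)); linarith)

/-- Separates noise from interference in the exponent. Positivity of `s` keeps the threshold
infinite when the interference is. -/
theorem expNeg_one_ofReal_mul {s c : ℝ} (hs : 0 < s) (hc : 0 ≤ c) (x : ℝ≥0∞) :
    expNeg 1 (ENNReal.ofReal s * (x + ENNReal.ofReal c)) = Real.exp (-s * c) * expNeg s x := by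
  unfold expNeg
  by_cases hx : x = ∞
  · have : ENNReal.ofReal s * (x + ENNReal.ofReal c) = ∞ := by
      rw [hx, top_add, ENNReal.mul_top (ENNReal.ofReal_pos.2 hs).ne']
    rw [if_pos this, if_pos hx, mul_zero]
  · have h1 : x + ENNReal.ofReal c ≠ ∞ := ENNReal.add_ne_top.2 ⟨hx, ENNReal.ofReal_ne_top⟩
    rw [if_neg (ENNReal.mul_ne_top ENNReal.ofReal_ne_top h1), if_neg hx, ENNReal.toReal_mul,
      ENNReal.toReal_add hx ENNReal.ofReal_ne_top, ENNReal.toReal_ofReal hs.le,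
      ENNReal.toReal_ofReal hc, ← Real.exp_add]
    congr 1; ring

/-- Argument of the Laplace transform of the interference for a serving base station at distance `R`
of tier and state `q`. -/
def _root_.MmWave.Params.laplaceArg (p : Params) (τ : ℝ) (q : Tier × Los) (R : ℝ) : ℝ :=
  τ * R ^ p.alpha q.2 / (p.C0 * p.pow .u * p.mainGain .u * p.mainGain q.1.kind)

theorem _root_.MmWave.Params.gain_pos (p : Params) (t : Tier) :
    0 < p.C0 * p.pow .u * p.mainGain .u * p.mainGain t.kind :=
  mul_pos (mul_pos (mul_pos p.C0_pos (p.pow_pos _)) (p.mainGain_pos _)) (p.mainGain_pos _)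

theorem _root_.MmWave.Params.laplaceArg_pos (p : Params) {τ : ℝ} (hτ : 0 < τ) (q : Tier × Los)
    {R : ℝ} (hR : 0 < R) : 0 < p.laplaceArg τ q R :=
  div_pos (mul_pos hτ (Real.rpow_pos_of_pos hR _)) (p.gain_pos _)

theorem _root_.MmWave.Params.measurable_laplaceArg (p : Params) (τ : ℝ) (q : Tier × Los) :
    Measurable (p.laplaceArg τ q) := by
  unfold Params.laplaceArg; fun_prop

variable {Ω : Type*}

/-- The type of the serving base station: its tier and link state. -/
def tagType (N : Network Ω) (p : Params) (ω : Ω) : Tier × Los := ((N.tagged p ω).1, N.tagLos p ω)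

/-- The value that the fading of the desired link has to exceed for coverage. -/
def fadingThreshold (N : Network Ω) (p : Params) (wa : AccessScheme) (wb : BackhaulScheme) (i : ℕ)
    (τ : ℝ) (ω : Ω) : ℝ≥0∞ :=
  ENNReal.ofReal (p.laplaceArg τ (N.tagType p ω) (N.tagDist p ω))
    * (N.interference p wa wb i ω + ENNReal.ofReal p.noise)

/-- Divide by the coefficient of the fading in the received signal, which is positive since the
distance is. As `τ` is positive and finite, this remains correct when interference plus noise is
zero or infinite. -/
theorem mem_covered_iff (N : Network Ω) (p : Params) (wa : AccessScheme) (wb : BackhaulScheme)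
    (i : ℕ) {τ : ℝ} (hτ : 0 < τ) {ω : Ω} (hω : 0 < N.tagDist p ω) :
    ω ∈ N.covered p wa wb i τ ↔ N.fadingThreshold p wa wb i τ ω
      < ENNReal.ofReal (N.fading i (.bs (N.tagged p ω)) .typ ω) := by
  have hL : N.pathLoss p (.bs (N.tagged p ω)) .typ ω
      = N.tagDist p ω ^ p.alpha (N.tagType p ω).2 := by
    simp only [pathLoss, tagDist, tagType, tagLos, pos, dist_zero_right]
  have hLpos : 0 < N.tagDist p ω ^ p.alpha (N.tagType p ω).2 := Real.rpow_pos_of_pos hω _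
  set c : ℝ := p.C0 * p.pow .u * p.mainGain .u * p.mainGain (N.tagged p ω).1.kind
    * (N.tagDist p ω ^ p.alpha (N.tagType p ω).2)⁻¹ with hc
  have hcpos : 0 < c := mul_pos (p.gain_pos _) (inv_pos.2 hLpos)
  have hτc : ENNReal.ofReal τ
      = ENNReal.ofReal c * ENNReal.ofReal (p.laplaceArg τ (N.tagType p ω) (N.tagDist p ω)) := by
    rw [← ENNReal.ofReal_mul hcpos.le]
    congr 1
    have := (p.gain_pos (N.tagged p ω).1).ne'
    rw [hc, Params.laplaceArg]
    change τ = p.C0 * p.pow .u * p.mainGain .u * p.mainGain (N.tagged p ω).1.kind * _ *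
      (_ / (p.C0 * p.pow .u * p.mainGain .u * p.mainGain (N.tagged p ω).1.kind))
    generalize p.C0 * p.pow .u * p.mainGain .u * p.mainGain (N.tagged p ω).1.kind = g at this ⊢
    field_simp
  have hnum : ENNReal.ofReal (p.C0 * p.pow .u * N.fading i (.bs (N.tagged p ω)) .typ ω
      * p.mainGain .u * p.mainGain (N.tagged p ω).1.kind
      * (N.pathLoss p (.bs (N.tagged p ω)) .typ ω)⁻¹)
      = ENNReal.ofReal c * ENNReal.ofReal (N.fading i (.bs (N.tagged p ω)) .typ ω) := by
    rw [← ENNReal.ofReal_mul hcpos.le, hL, hc]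
    congr 1; ring
  change ENNReal.ofReal τ < N.sinr p wa wb i ω ↔ _
  rw [sinr, ENNReal.lt_div_iff_mul_lt (.inr ENNReal.ofReal_ne_top)
    (.inr (ENNReal.ofReal_pos.2 hτ).ne'), hnum, hτc, mul_assoc,
    ENNReal.mul_lt_mul_iff_right (ENNReal.ofReal_pos.2 hcpos).ne' ENNReal.ofReal_ne_top]
  rfl

theorem GeometryMeasurable.tagType [MeasurableSpace Ω] {N : Network Ω} (h : N.GeometryMeasurable)
    (p : Params) : Measurable (N.tagType p) :=
  (measurable_fst.comp (h.tagged p)).prodMk (h.tagLos p)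

theorem InterferenceMeasurable.fadingThreshold [MeasurableSpace Ω] {N : Network Ω} {i : ℕ}
    (h : N.InterferenceMeasurable i) (p : Params) (wa : AccessScheme) (wb : BackhaulScheme)
    (τ : ℝ) : Measurable (N.fadingThreshold p wa wb i τ) :=
  (measurable_eval_countable (g := fun q ω => p.laplaceArg τ q (N.tagDist p ω)) (h.tagType p)
    fun q => (p.measurable_laplaceArg τ q).comp (h.tagDist p)).ennreal_ofReal.mul
    ((h.interference p wa wb).add_const _)

/-- Positions and blockage do not depend on the slot, so slot `0` serves for all slots. -/
theorem geometryMeasurable_sourceSigma (N : Network Ω) : @GeometryMeasurable Ω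
    (N.sourceSigma 0 (range Source.point ∪ range Source.blockage)) N :=
  N.geometryMeasurable_of_source 0 (fun k => .inl ⟨k, rfl⟩) fun e => .inr ⟨e, rfl⟩

namespace IsModel

variable [MeasurableSpace Ω] {P : Measure Ω} {p : Params} {N : Network Ω}

theorem measurableSet_covered (hN : N.IsModel p P) (wa : AccessScheme) (wb : BackhaulScheme)
    (i : ℕ) (τ : ℝ) : MeasurableSet (N.covered p wa wb i τ) := by
  have h := hN.interferenceMeasurable i
  have h1 : Measurable fun ω => ENNReal.ofReal (p.C0 * p.pow .u
      * N.fading i (.bs (N.tagged p ω)) .typ ω * p.mainGain .u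
      * p.mainGain (N.tagged p ω).1.kind * (N.pathLoss p (.bs (N.tagged p ω)) .typ ω)⁻¹) :=
    measurable_eval_countable (g := fun b ω => ENNReal.ofReal (p.C0 * p.pow .u
      * N.fading i (.bs b) .typ ω * p.mainGain .u
      * p.mainGain b.1.kind * (N.pathLoss p (.bs b) .typ ω)⁻¹)) (h.tagged p) fun b =>
      (((((hN.measurable i (.fading (.bs b) .typ)).const_mul _).mul_const _).mul_const _).mul
        (h.pathLoss p _ _).inv).ennreal_ofReal
  exact measurableSet_lt measurable_const (h1.div ((h.interference p wa wb).add_const _))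

theorem measurableSet_frame (hN : N.IsModel p P) (wa : AccessScheme) (S : Set (ℕ × ℕ × ℕ)) :
    MeasurableSet (N.frame p wa ⁻¹' S) :=
  measurable_frame (fun c => hN.measurable 0 (.frameCoin c)) p wa .of_discrete

/-- The common subframe lengths depend on the frame coins alone, a set of sources disjoint from
positions and blockage. -/
theorem indep_frame (hN : N.IsModel p P) (wa : AccessScheme) (S : Set (ℕ × ℕ × ℕ)) {A : Set Ω}
    (hA : MeasurableSet[N.sourceSigma 0 (range Source.point ∪ range Source.blockage)] A) :
    P (N.frame p wa ⁻¹' S ∩ A) = P (N.frame p wa ⁻¹' S) * P A := by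
  have hd : Disjoint (range Source.frameCoin) (range Source.point ∪ range Source.blockage) := by
    refine Set.disjoint_left.2 ?_
    rintro _ ⟨c, rfl⟩ (⟨k, hk⟩ | ⟨e, he⟩)
    · cases hk
    · cases he
  have hf : MeasurableSet[N.sourceSigma 0 (range Source.frameCoin)] (N.frame p wa ⁻¹' S) := by
    let _ := N.sourceSigma 0 (range Source.frameCoin)
    exact measurable_frame (fun c => N.measurable_source_sourceSigma 0
      (s := .frameCoin c) (mem_range_self c)) p wa (.of_discrete)
  exact Indep_iff _ _ _ |>.1 (hN.indep_sourceSigma 0 hd) _ _ hf hA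

variable [IsProbabilityMeasure P]

theorem ae_tagDist_pos (hN : N.IsModel p P) : ∀ᵐ ω ∂P, 0 < N.tagDist p ω :=
  hN.ae_biasedPower_le_tagged.mono fun _ h => h.1 _

/-- The sources of randomness other than the fading of the links to the typical user. -/
abbrev _root_.MmWave.Source.others : Set Source := {s | ∀ x, s ≠ .fading x .typ}

/-- Given all sources in `Source.others`, coverage means that an independent exponential variable
exceeds a known threshold. That variable is not one fixed source, since the receiver is random; on
each event `X* = b` it is the fading of the link to `b`, and the pieces are summed. -/
theorem measure_covered_inter (hN : N.IsModel p P) (wa : AccessScheme) (wb : BackhaulScheme)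
    (i : ℕ) {τ : ℝ} (hτ : 0 < τ) {E : Set Ω}
    (hE : MeasurableSet[N.sourceSigma i Source.others] E) :
    P (E ∩ N.covered p wa wb i τ)
      = ∫⁻ ω in E, ENNReal.ofReal (expNeg 1 (N.fadingThreshold p wa wb i τ ω)) ∂P := by
  classical
  have hle := hN.sourceSigma_le i Source.others
  have hI := N.interferenceMeasurable_of_source i (S := Source.others) fun s hs => hs
  have hEb (b : BS) : MeasurableSet[N.sourceSigma i Source.others] (E ∩ {ω | N.tagged p ω = b}) :=
    let _ := N.sourceSigma i Source.others
    hE.inter (hI.tagged p (measurableSet_singleton b))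
  have hEU : E = ⋃ b, E ∩ {ω | N.tagged p ω = b} := by
    ext ω; simp
  have hdisj : Pairwise (Function.onFun Disjoint fun b => E ∩ {ω | N.tagged p ω = b}) :=
    fun b b' hbb' => Set.disjoint_left.2 fun ω h h' => hbb' (h.2.symm.trans h'.2)
  have hb (b : BS) : P ((E ∩ {ω | N.tagged p ω = b}) ∩ N.covered p wa wb i τ)
      = ∫⁻ ω in E ∩ {ω | N.tagged p ω = b},
        ENNReal.ofReal (expNeg 1 (N.fadingThreshold p wa wb i τ ω)) ∂P := by
    set A := E ∩ {ω | N.tagged p ω = b} with hA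
    set s : Source := .fading (.bs b) .typ with hs
    -- An infinite threshold is never exceeded, so the value `∞` off `A` encodes the restriction to
    -- `A` in a single frozen variable.
    let Z : Ω → ℝ≥0∞ := fun ω => if ω ∈ A then N.fadingThreshold p wa wb i τ ω else ∞
    have hsub : N.sourceSigma i Source.others ≤ N.sourceSigma i {s}ᶜ :=
      iSup₂_le fun t ht => le_iSup₂_of_le t (ht _) le_rfl
    have hZ : Measurable[N.sourceSigma i {s}ᶜ] Z := by
      refine Measurable.mono ?_ hsub le_rfl
      let _ := N.sourceSigma i Source.others
      exact Measurable.ite (hEb b) (hI.fadingThreshold p wa wb τ) measurable_const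
    have hset : (A ∩ N.covered p wa wb i τ : Set Ω)
        =ᵐ[P] {ω | Z ω < ENNReal.ofReal (N.fading i (.bs b) .typ ω)} := by
      filter_upwards [hN.ae_tagDist_pos] with ω hω
      refine propext ?_
      change ω ∈ A ∧ ω ∈ N.covered p wa wb i τ ↔ Z ω < ENNReal.ofReal (N.fading i (.bs b) .typ ω)
      by_cases hωA : ω ∈ A
      · simp only [hωA, true_and, Z, if_true, N.mem_covered_iff p wa wb i hτ hω]
        rw [show N.tagged p ω = b from hωA.2]
      · simp [hωA, Z]
    have hF : MeasurableSet {q : ℝ × ℝ≥0∞ | q.2 < ENNReal.ofReal q.1} :=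
      measurableSet_lt measurable_snd measurable_fst.ennreal_ofReal
    have key := lintegral_comp_prodMk_of_indep (P := P) (hN.sourceSigma_le i _)
      (hN.measurable i s) (hN.indep_source i s) hZ
      (f := fun q : ℝ × ℝ≥0∞ => {q : ℝ × ℝ≥0∞ | q.2 < ENNReal.ofReal q.1}.indicator 1 q)
      (measurable_one.indicator hF)
    have hmap : P.map (N.source i s) = expMeasure 1 := hN.fading i _ _
    rw [hmap] at key
    rw [measure_congr hset]
    have h1 : P {ω | Z ω < ENNReal.ofReal (N.fading i (.bs b) .typ ω)} = ∫⁻ ω,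
        {q : ℝ × ℝ≥0∞ | q.2 < ENNReal.ofReal q.1}.indicator 1 (N.source i s ω, Z ω) ∂P :=
      (lintegral_indicator_one (((hN.measurable i s).prodMk
        (hZ.mono (hN.sourceSigma_le i _) le_rfl)) hF)).symm
    rw [h1]
    refine key.trans ?_
    rw [← lintegral_indicator (show MeasurableSet A from hle _ (hEb b))]
    refine lintegral_congr fun ω => ?_
    refine (lintegral_indicator_one (μ := expMeasure 1)
      (s := {h : ℝ | Z ω < ENNReal.ofReal h}) (measurable_prodMk_right hF)).trans ?_
    rw [expMeasure_one_lt_ofReal]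
    by_cases hωA : ω ∈ A
    · rw [indicator_of_mem hωA, show Z ω = _ from if_pos hωA]
    · rw [indicator_of_notMem hωA, show Z ω = ∞ from if_neg hωA]
      simp [expNeg]
  conv_lhs => rw [hEU]
  rw [iUnion_inter, measure_iUnion (fun b b' h => (hdisj h).mono inter_subset_left inter_subset_left)
    fun b => (hle _ (hEb b)).inter (hN.measurableSet_covered wa wb i τ)]
  conv_rhs => rw [hEU]
  rw [lintegral_iUnion (fun b => hle _ (hEb b)) hdisj]
  exact tsum_congr hb

/-- Disintegration along the distance: the conditional law of the interference produces `laplace`,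
the law of the distance on the type event produces `servingDensity`, and the frame contributes only
its probability. The product form avoids dividing by probabilities that may vanish. -/
theorem measureReal_inter_typeEvent_covered (hN : N.IsModel p P) (wa : AccessScheme)
    (wb : BackhaulScheme) (i : ℕ) {τ : ℝ} (hτ : 0 < τ) (f : ℕ × ℕ × ℕ) (t : Tier) (a : Los) :
    P.real (({ω | N.frame p wa ω = f} ∩ N.typeEvent p t a) ∩ N.covered p wa wb i τ)
      = P.real {ω | N.frame p wa ω = f} * ∫ R in Ioi 0, p.servingDensity (t, a) R
        * (Real.exp (-p.laplaceArg τ (t, a) R * p.noise)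
          * N.laplace p P wa wb i f t a (p.laplaceArg τ (t, a) R) R) := by
  have hgeo := hN.geometryMeasurable
  have hI := hN.interferenceMeasurable i
  set q : Tier × Los := (t, a) with hq
  set Fr : Set Ω := {ω | N.frame p wa ω = f} with hFr
  have hFrm : MeasurableSet Fr := hN.measurableSet_frame wa {f}
  set A := Fr ∩ N.typeEvent p t a with hA
  have hAm : MeasurableSet A := hFrm.inter (hgeo.typeEvent p t a)
  have hAo : MeasurableSet[N.sourceSigma i Source.others] A := by
    have hI' := N.interferenceMeasurable_of_source i (S := Source.others) fun s hs => hs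
    let _ := N.sourceSigma i Source.others
    exact (measurable_frame hI'.frameCoin p wa (measurableSet_singleton f)).inter
      (hI'.typeEvent p t a)
  let φ : ℝ × ℝ≥0∞ → ℝ := fun x =>
    Real.exp (-p.laplaceArg τ q x.1 * p.noise) * expNeg (p.laplaceArg τ q x.1) x.2
  have hφ : Measurable φ := (((p.measurable_laplaceArg τ q).comp measurable_fst).neg.mul_const
    _).exp.mul (measurable_expNeg.comp
      (((p.measurable_laplaceArg τ q).comp measurable_fst).prodMk measurable_snd))
  let Q : Measure Ω := P[|A]
  -- If `A` is null then `Q` is the zero measure, so this scaled identity covers both cases.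
  have hQ : (P A) • Q = P.restrict A := by
    rcases eq_or_ne (P A) 0 with h0 | h0
    · rw [h0, zero_smul, Measure.restrict_eq_zero.2 h0]
    · change P A • ((P A)⁻¹ • P.restrict A) = _
      rw [smul_smul, ENNReal.mul_inv_cancel h0 (measure_ne_top _ _), one_smul]
  have h1 : P.real (A ∩ N.covered p wa wb i τ)
      = ∫ ω in A, φ (N.tagDist p ω, N.interference p wa wb i ω) ∂P := by
    rw [Measure.real, hN.measure_covered_inter wa wb i hτ hAo]
    have hae : ∀ᵐ ω ∂(P.restrict A), expNeg 1 (N.fadingThreshold p wa wb i τ ω)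
        = φ (N.tagDist p ω, N.interference p wa wb i ω) := by
      filter_upwards [ae_restrict_mem hAm, ae_restrict_of_ae hN.ae_tagDist_pos] with ω hω hpos
      have hty : N.tagType p ω = q := Prod.ext hω.2.1 hω.2.2
      rw [fadingThreshold, hty, expNeg_one_ofReal_mul (p.laplaceArg_pos hτ _ hpos) p.noise_nonneg]
    rw [lintegral_congr_ae (hae.mono fun ω h => congrArg ENNReal.ofReal h),
      integral_eq_lintegral_of_nonneg_ae
        (ae_of_all _ fun ω => mul_nonneg (Real.exp_pos _).le (expNeg_nonneg _ _))
        (hφ.comp ((hgeo.tagDist p).prodMk (hI.interference p wa wb))).aestronglyMeasurable]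
  -- A conditional distribution is determined only up to null sets of distances; integrating against
  -- the law of the distance makes the choice of version irrelevant.
  have h2 : ∫ ω, φ (N.tagDist p ω, N.interference p wa wb i ω) ∂Q
      = ∫ R, Real.exp (-p.laplaceArg τ q R * p.noise)
          * N.laplace p P wa wb i f t a (p.laplaceArg τ q R) R ∂(Q.map (N.tagDist p)) := by
    have hc := compProd_map_condDistrib (μ := Q) (mβ := inferInstance) (X := N.tagDist p)
      (hI.interference p wa wb).aemeasurable
    have hpos : ∀ᵐ ω ∂Q, 0 < N.tagDist p ω := cond_absolutelyContinuous hN.ae_tagDist_pos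
    have hint : Integrable φ (Q.map fun ω => (N.tagDist p ω, N.interference p wa wb i ω)) := by
      refine Integrable.of_bound hφ.aestronglyMeasurable 1 ?_
      rw [ae_map_iff ((hgeo.tagDist p).prodMk (hI.interference p wa wb)).aemeasurable
        (measurableSet_le hφ.norm measurable_const)]
      filter_upwards [hpos] with ω hω
      have hs := p.laplaceArg_pos hτ q hω
      rw [Real.norm_of_nonneg (mul_nonneg (Real.exp_pos _).le (expNeg_nonneg _ _))]
      refine mul_le_one₀ (Real.exp_le_one_iff.2 ?_) (expNeg_nonneg _ _) (expNeg_le_one hs.le _)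
      have := mul_nonneg hs.le p.noise_nonneg
      linarith
    rw [← integral_map ((hgeo.tagDist p).prodMk (hI.interference p wa wb)).aemeasurable
      hφ.aestronglyMeasurable]
    rw [← hc] at hint ⊢
    rw [Measure.integral_compProd hint]
    refine integral_congr_ae (ae_of_all _ fun R => ?_)
    simp only [φ, integral_const_mul]
    rfl
  -- The distance and the type are functions of positions and blockage, hence independent of the
  -- frame: conditioning on the frame only scales the law of the distance.
  have h3 : (P A) • Q.map (N.tagDist p) = P Fr • (volume.restrict (Ioi (0 : ℝ))).withDensity
      fun R => ENNReal.ofReal (p.servingDensity q R) := by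
    rw [← Measure.map_smul, hQ, ← hN.map_tagDist t a]
    refine Measure.ext fun B hB => ?_
    rw [Measure.map_apply (hgeo.tagDist p) hB, Measure.smul_apply,
      Measure.map_apply (hgeo.tagDist p) hB, Measure.restrict_apply (hgeo.tagDist p hB),
      Measure.restrict_apply (hgeo.tagDist p hB), smul_eq_mul]
    have hm : MeasurableSet[N.sourceSigma 0 (range Source.point ∪ range Source.blockage)]
        (N.tagDist p ⁻¹' B ∩ N.typeEvent p t a) := by
      have hg := geometryMeasurable_sourceSigma N
      let _ := N.sourceSigma 0 (range Source.point ∪ range Source.blockage)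
      exact (hg.tagDist p hB).inter (hg.typeEvent p t a)
    rw [hA, inter_left_comm]
    exact hN.indep_frame wa {f} hm
  have hden : Measurable fun R => ENNReal.ofReal (p.servingDensity q R) :=
    ((Finset.measurable_prod _ fun q' _ => (p.continuous_voidProb _ _).measurable.comp
      (p.measurable_exclusionRadius q q')).mul (p.measurable_nearestDensity _ _)).ennreal_ofReal
  rw [h1, ← hQ, integral_smul_measure, h2, ← integral_smul_measure, h3, integral_smul_measure,
    integral_withDensity_eq_integral_toReal_smul hden (ae_of_all _ fun _ => ENNReal.ofReal_lt_top),
    smul_eq_mul]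
  congr 1
  refine setIntegral_congr_fun measurableSet_Ioi fun R hR => ?_
  have h0 : 0 ≤ p.servingDensity q R := mul_nonneg
    (Finset.prod_nonneg fun _ _ => (p.voidProb_pos _ _ _).le)
    (p.nearestDensity_nonneg _ _ (le_of_lt hR))
  simp only [ENNReal.toReal_ofReal h0, smul_eq_mul]

end IsModel

end Network

/-! ### Conditional and averaged coverage -/

theorem measureReal_cond {Ω : Type*} [MeasurableSpace Ω] (P : Measure Ω) {S : Set Ω}
    (hS : MeasurableSet S) (C : Set Ω) : (P[|S]).real C = (P.real S)⁻¹ * P.real (S ∩ C) := by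
  rw [Measure.real, cond_apply hS, ENNReal.toReal_mul, ENNReal.toReal_inv]
  rfl

theorem integral_cond_eq {Ω : Type*} [MeasurableSpace Ω] (P : Measure Ω) (S : Set Ω) (g : Ω → ℝ) :
    ∫ ω, g ω ∂(P[|S]) = (P.real S)⁻¹ * ∫ ω in S, g ω ∂P := by
  rw [ProbabilityTheory.cond, integral_smul_measure, ENNReal.toReal_inv, smul_eq_mul]
  rfl

/-- Averaging over a discrete random element. -/
theorem measureReal_inter_preimage_eq_setIntegral {Ω ι : Type*} [MeasurableSpace Ω]
    [MeasurableSpace ι] [DiscreteMeasurableSpace ι] [Countable ι] {P : Measure Ω}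
    [IsFiniteMeasure P] {T : Ω → ι} (hT : Measurable T) {C : Set Ω} (hC : MeasurableSet C)
    (S : Set ι) {c : ι → ℝ}
    (h : ∀ f ∈ S, P.real ({ω | T ω = f} ∩ C) = P.real {ω | T ω = f} * c f) :
    P.real (T ⁻¹' S ∩ C) = ∫ ω in T ⁻¹' S, c (T ω) ∂P := by
  have hm (f : ι) : MeasurableSet {ω | T ω = f} := hT (measurableSet_singleton f)
  have hU : T ⁻¹' S = ⋃ f : S, {ω | T ω = f} := by
    ext ω; simp
  have hdisj : Pairwise (Function.onFun Disjoint fun f : S => {ω | T ω = f}) := fun f f' hff' =>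
    Set.disjoint_left.2 fun ω h1 h2 => hff' (Subtype.ext ((Eq.symm h1).trans h2))
  -- Where `{T = f}` has positive mass, `c f` is a conditional probability. Elsewhere it is
  -- arbitrary, so integrability comes from an almost sure bound.
  have hbound (f : ι) (hf : f ∈ S) (h0 : P.real {ω | T ω = f} ≠ 0) : ‖c f‖ ≤ 1 := by
    have hpos : 0 < P.real {ω | T ω = f} := lt_of_le_of_ne measureReal_nonneg h0.symm
    have h1 : c f = P.real ({ω | T ω = f} ∩ C) / P.real {ω | T ω = f} := by
      rw [h f hf, mul_div_cancel_left₀ _ h0]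
    rw [h1, Real.norm_of_nonneg (div_nonneg measureReal_nonneg hpos.le), div_le_one hpos]
    exact measureReal_mono inter_subset_left
  have hint : IntegrableOn (fun ω => c (T ω)) (T ⁻¹' S) P := by
    refine Integrable.of_bound (Measurable.of_discrete.comp hT).aestronglyMeasurable 1 ?_
    have hall : ∀ᵐ ω ∂P, ∀ f, P.real {ω | T ω = f} = 0 → T ω ≠ f := by
      refine ae_all_iff.2 fun f => ?_
      by_cases h0 : P.real {ω | T ω = f} = 0
      · have h0' : P {ω | T ω = f} = 0 := (measureReal_eq_zero_iff).1 h0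
        filter_upwards [measure_eq_zero_iff_ae_notMem.1 h0'] with ω hω _ using hω
      · exact ae_of_all _ fun ω h' => absurd h' h0
    filter_upwards [ae_restrict_mem (hT .of_discrete), ae_restrict_of_ae hall] with ω hω hne
    exact hbound _ hω fun h0 => hne _ h0 rfl
  have hCint : IntegrableOn (C.indicator fun _ => (1 : ℝ)) (T ⁻¹' S) P :=
    ((integrable_const _).indicator hC).integrableOn
  have h1 : P.real (T ⁻¹' S ∩ C) = ∫ ω in T ⁻¹' S, C.indicator (fun _ => (1 : ℝ)) ω ∂P := by
    rw [setIntegral_indicator hC, setIntegral_const, smul_eq_mul, mul_one]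
  rw [h1]
  rw [hU] at hint hCint ⊢
  rw [integral_iUnion (fun f : S => hm f) hdisj hint,
    integral_iUnion (fun f : S => hm f) hdisj hCint]
  refine tsum_congr fun f => ?_
  rw [setIntegral_indicator hC, setIntegral_const, smul_eq_mul, mul_one, h f f.2,
    setIntegral_congr_fun (g := fun _ => c f) (hm f) fun ω hω => congrArg c hω, setIntegral_const,
    smul_eq_mul]

namespace Network

theorem tierCoverage_eq {Ω : Type*} [MeasurableSpace Ω] (N : Network Ω) (p : Params) (P : Measure Ω)
    (wa : AccessScheme) (wb : BackhaulScheme) (i : ℕ) (τ : ℝ) (t : Tier) (f : ℕ × ℕ × ℕ) :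
    N.tierCoverage p P wa wb i τ t f = (∑ a, ∫ R in Ioi 0, p.servingDensity (t, a) R
        * (Real.exp (-p.laplaceArg τ (t, a) R * p.noise)
          * N.laplace p P wa wb i f t a (p.laplaceArg τ (t, a) R) R)) / N.assocProb p P t := by
  rw [tierCoverage, Finset.sum_div]
  refine Finset.sum_congr rfl fun a _ => ?_
  rw [← integral_div]
  congr 1
  ext R
  have hexp : -τ * R ^ p.alpha a * p.noise / (p.C0 * p.pow .u * p.mainGain .u * p.mainGain t.kind)
      = -p.laplaceArg τ (t, a) R * p.noise := by
    rw [Params.laplaceArg]; ring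
  rw [hexp]
  simp only [Params.servingDensity, Params.exclusionRadius, Params.laplaceArg]
  ring

namespace IsModel

variable {Ω : Type*} [MeasurableSpace Ω] {P : Measure Ω} {p : Params} {N : Network Ω}

theorem measureReal_frame_inter_tierEvent (hN : N.IsModel p P) (wa : AccessScheme)
    (S : Set (ℕ × ℕ × ℕ)) (t : Tier) :
    P.real (N.frame p wa ⁻¹' S ∩ N.tierEvent p t)
      = P.real (N.frame p wa ⁻¹' S) * N.assocProb p P t := by
  have hm : MeasurableSet[N.sourceSigma 0 (range Source.point ∪ range Source.blockage)]
      (N.tierEvent p t) :=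
    @GeometryMeasurable.tierEvent Ω (_) N (geometryMeasurable_sourceSigma N) p t
  rw [Measure.real, hN.indep_frame wa S hm, ENNReal.toReal_mul]
  rfl

variable [IsProbabilityMeasure P]

/-- Sum over the two link states. For a tier of association probability zero both sides vanish, so
the product form needs no positivity. -/
theorem measureReal_frame_inter_tierEvent_covered (hN : N.IsModel p P) (wa : AccessScheme)
    (wb : BackhaulScheme) (i : ℕ) {τ : ℝ} (hτ : 0 < τ) (f : ℕ × ℕ × ℕ) (t : Tier) :
    P.real (({ω | N.frame p wa ω = f} ∩ N.tierEvent p t) ∩ N.covered p wa wb i τ)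
      = P.real {ω | N.frame p wa ω = f}
        * (N.assocProb p P t * N.tierCoverage p P wa wb i τ t f) := by
  rcases eq_or_ne (N.assocProb p P t) 0 with h0 | h0
  · rw [h0, zero_mul, mul_zero]
    have h1 := hN.measureReal_frame_inter_tierEvent wa {f} t
    rw [h0, mul_zero] at h1
    refine le_antisymm ?_ measureReal_nonneg
    exact (measureReal_mono inter_subset_left).trans h1.le
  · rw [tierCoverage_eq, mul_div_cancel₀ _ h0]
    have hcov := hN.measurableSet_covered wa wb i τ
    have hF : MeasurableSet {ω | N.frame p wa ω = f} := hN.measurableSet_frame wa {f}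
    have huniv : (Finset.univ : Finset Los) = {.l, .n} := rfl
    have hset : (({ω | N.frame p wa ω = f} ∩ N.tierEvent p t) ∩ N.covered p wa wb i τ)
        = (({ω | N.frame p wa ω = f} ∩ N.typeEvent p t .l) ∩ N.covered p wa wb i τ)
          ∪ (({ω | N.frame p wa ω = f} ∩ N.typeEvent p t .n) ∩ N.covered p wa wb i τ) := by
      ext ω
      have : N.tagLos p ω = .l ∨ N.tagLos p ω = .n := by cases N.tagLos p ω <;> simp
      simp only [mem_inter_iff, mem_union, typeEvent, tierEvent, mem_ofPred_eq]
      tauto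
    have hdisj : Disjoint (({ω | N.frame p wa ω = f} ∩ N.typeEvent p t .l) ∩ N.covered p wa wb i τ)
        (({ω | N.frame p wa ω = f} ∩ N.typeEvent p t .n) ∩ N.covered p wa wb i τ) :=
      Set.disjoint_left.2 fun ω h1 h2 => by
        have := h1.1.2.2.symm.trans h2.1.2.2
        cases this
    rw [hset, measureReal_union hdisj ((hF.inter (hN.geometryMeasurable.typeEvent p t .n)).inter
      hcov), hN.measureReal_inter_typeEvent_covered wa wb i hτ,
      hN.measureReal_inter_typeEvent_covered wa wb i hτ, huniv, Finset.sum_pair (by simp), mul_add]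

theorem measureReal_frame_inter_covered (hN : N.IsModel p P) (wa : AccessScheme)
    (wb : BackhaulScheme) (i : ℕ) {τ : ℝ} (hτ : 0 < τ) (f : ℕ × ℕ × ℕ) :
    P.real ({ω | N.frame p wa ω = f} ∩ N.covered p wa wb i τ)
      = P.real {ω | N.frame p wa ω = f} * N.coverage p P wa wb i τ f := by
  have hcov := hN.measurableSet_covered wa wb i τ
  have hF : MeasurableSet {ω | N.frame p wa ω = f} := hN.measurableSet_frame wa {f}
  have hset : {ω | N.frame p wa ω = f} ∩ N.covered p wa wb i τ
      = (({ω | N.frame p wa ω = f} ∩ N.tierEvent p .m) ∩ N.covered p wa wb i τ)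
        ∪ (({ω | N.frame p wa ω = f} ∩ N.tierEvent p .s) ∩ N.covered p wa wb i τ) := by
    ext ω
    have : (N.tagged p ω).1 = .m ∨ (N.tagged p ω).1 = .s := by cases (N.tagged p ω).1 <;> simp
    simp only [mem_inter_iff, mem_union, tierEvent, mem_ofPred_eq]
    tauto
  have hdisj : Disjoint (({ω | N.frame p wa ω = f} ∩ N.tierEvent p .m) ∩ N.covered p wa wb i τ)
      (({ω | N.frame p wa ω = f} ∩ N.tierEvent p .s) ∩ N.covered p wa wb i τ) :=
    Set.disjoint_left.2 fun ω h1 h2 => by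
      have := h1.1.2.symm.trans h2.1.2
      cases this
  rw [hset, measureReal_union hdisj ((hF.inter (hN.geometryMeasurable.tierEvent p .s)).inter hcov),
    hN.measureReal_frame_inter_tierEvent_covered wa wb i hτ,
    hN.measureReal_frame_inter_tierEvent_covered wa wb i hτ, ← mul_add]
  rfl

theorem cond_frame_inter_tierEvent_covered (hN : N.IsModel p P) (wa : AccessScheme)
    (wb : BackhaulScheme) (i : ℕ) {τ : ℝ} (hτ : 0 < τ) {f : ℕ × ℕ × ℕ}
    (hf : P {ω | N.frame p wa ω = f} ≠ 0) (t : Tier) :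
    (P[|{ω | N.frame p wa ω = f} ∩ N.tierEvent p t]).real (N.covered p wa wb i τ)
      = N.tierCoverage p P wa wb i τ t f := by
  have hF : MeasurableSet {ω | N.frame p wa ω = f} := hN.measurableSet_frame wa {f}
  have h1 : P.real ({ω | N.frame p wa ω = f} ∩ N.tierEvent p t)
      = P.real {ω | N.frame p wa ω = f} * N.assocProb p P t :=
    hN.measureReal_frame_inter_tierEvent wa {f} t
  have hf' : P.real {ω | N.frame p wa ω = f} ≠ 0 :=
    (ENNReal.toReal_ne_zero).2 ⟨hf, measure_ne_top _ _⟩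
  rw [measureReal_cond _ (hF.inter (hN.geometryMeasurable.tierEvent p t)), h1,
    hN.measureReal_frame_inter_tierEvent_covered wa wb i hτ]
  rcases eq_or_ne (N.assocProb p P t) 0 with h0 | h0
  -- Conditioning on a null event and dividing by a zero association probability both give `0`.
  · rw [h0, tierCoverage_eq, h0]; simp
  · field_simp

theorem cond_frame_covered (hN : N.IsModel p P) (wa : AccessScheme)
    (wb : BackhaulScheme) (i : ℕ) {τ : ℝ} (hτ : 0 < τ) {f : ℕ × ℕ × ℕ}
    (hf : P {ω | N.frame p wa ω = f} ≠ 0) :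
    (P[|{ω | N.frame p wa ω = f}]).real (N.covered p wa wb i τ) = N.coverage p P wa wb i τ f := by
  have hf' : P.real {ω | N.frame p wa ω = f} ≠ 0 :=
    (ENNReal.toReal_ne_zero).2 ⟨hf, measure_ne_top _ _⟩
  have hF : MeasurableSet {ω | N.frame p wa ω = f} := hN.measurableSet_frame wa {f}
  rw [measureReal_cond _ hF, hN.measureReal_frame_inter_covered wa wb i hτ,
    inv_mul_cancel_left₀ hf']

theorem cond_frame_mem_covered (hN : N.IsModel p P) (wa : AccessScheme)
    (wb : BackhaulScheme) (i : ℕ) {τ : ℝ} (hτ : 0 < τ) (S : Set (ℕ × ℕ × ℕ)) :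
    (P[|N.frame p wa ⁻¹' S]).real (N.covered p wa wb i τ)
      = ∫ ω, N.coverage p P wa wb i τ (N.frame p wa ω) ∂(P[|N.frame p wa ⁻¹' S]) := by
  rw [integral_cond_eq, measureReal_cond _ (hN.measurableSet_frame wa S),
    measureReal_inter_preimage_eq_setIntegral
      (measurable_frame (fun c => hN.measurable 0 (.frameCoin c)) p wa)
      (hN.measurableSet_covered wa wb i τ) S
      fun f _ => hN.measureReal_frame_inter_covered wa wb i hτ f]

/-- The average on the right is conditioned on the frame event only, not on the tier: frame and
serving tier are independent, and the association probability cancels. -/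
theorem cond_frame_mem_inter_tierEvent_covered (hN : N.IsModel p P) (wa : AccessScheme)
    (wb : BackhaulScheme) (i : ℕ) {τ : ℝ} (hτ : 0 < τ) (S : Set (ℕ × ℕ × ℕ)) (t : Tier) :
    (P[|N.frame p wa ⁻¹' S ∩ N.tierEvent p t]).real (N.covered p wa wb i τ)
      = ∫ ω, N.tierCoverage p P wa wb i τ t (N.frame p wa ω) ∂(P[|N.frame p wa ⁻¹' S]) := by
  have hT := hN.geometryMeasurable.tierEvent p t
  have h1 := measureReal_inter_preimage_eq_setIntegral (P := P)
    (measurable_frame (fun c => hN.measurable 0 (.frameCoin c)) p wa)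
    (hT.inter (hN.measurableSet_covered wa wb i τ)) S
    (c := fun f => N.assocProb p P t * N.tierCoverage p P wa wb i τ t f) fun f _ => by
      rw [← inter_assoc]
      exact hN.measureReal_frame_inter_tierEvent_covered wa wb i hτ f t
  rw [integral_cond_eq, measureReal_cond _ ((hN.measurableSet_frame wa S).inter hT), inter_assoc, h1,
    hN.measureReal_frame_inter_tierEvent, integral_const_mul]
  rcases eq_or_ne (N.assocProb p P t) 0 with h0 | h0
  · have h2 (f) : N.tierCoverage p P wa wb i τ t f = 0 := by rw [tierCoverage_eq, h0, div_zero]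
    simp [h2]
  · rw [mul_inv, mul_assoc, inv_mul_cancel_left₀ h0]

end IsModel

end Network

end MmWave

end

/-- Uplink access SINR coverage of the typical user in slot `i`. First part: access slots, static or
dynamic TDD. Second part: backhaul slots under UAB. In each part the coverage is given first
conditionally on the common subframe lengths, then averaged over them. -/
theorem theorem1 {Ω : Type*} [MeasurableSpace Ω] (P : Measure Ω) [IsProbabilityMeasure P]
    (p : MmWave.Params) (N : MmWave.Network Ω) (hN : N.IsModel p P)
    (i : ℕ) (hi : i ∈ Finset.Icc 1 p.F) (τ : ℝ) (hτ : 0 < τ) (wa : MmWave.AccessScheme) :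
    (∀ wb : MmWave.BackhaulScheme,
      (∀ f : ℕ × ℕ × ℕ, P {ω | N.frame p wa ω = f} ≠ 0 → i ≤ f.1 →
        (∀ t : MmWave.Tier,
          (P[|{ω | N.frame p wa ω = f} ∩ N.tierEvent p t]).real (N.covered p wa wb i τ)
            = N.tierCoverage p P wa wb i τ t f) ∧
        (P[|{ω | N.frame p wa ω = f}]).real (N.covered p wa wb i τ)
          = N.coverage p P wa wb i τ f) ∧
      (P[|{ω | i ≤ N.Fa p ω}]).real (N.covered p wa wb i τ)
        = ∫ ω, N.coverage p P wa wb i τ (N.frame p wa ω) ∂(P[|{ω | i ≤ N.Fa p ω}])) ∧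
    ((∀ f : ℕ × ℕ × ℕ, P {ω | N.frame p wa ω = f} ≠ 0 → f.1 < i →
        (P[|{ω | N.frame p wa ω = f} ∩ N.tierEvent p .s]).real (N.covered p wa .UAB i τ)
          = N.tierCoverage p P wa .UAB i τ .s f) ∧
      (P[|{ω | N.Fa p ω < i} ∩ N.tierEvent p .s]).real (N.covered p wa .UAB i τ)
        = ∫ ω, N.tierCoverage p P wa .UAB i τ .s (N.frame p wa ω) ∂(P[|{ω | N.Fa p ω < i}])) := by
  refine ⟨fun wb => ⟨fun f hf _ => ⟨fun t => ?_, ?_⟩, ?_⟩, fun f hf _ => ?_, ?_⟩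
  · exact hN.cond_frame_inter_tierEvent_covered wa wb i hτ hf t
  · exact hN.cond_frame_covered wa wb i hτ hf
  -- The first component of `frame` is the number of access slots, so the conditioning event is by
  -- definition a preimage under `frame`.
  · exact hN.cond_frame_mem_covered wa wb i hτ {f | i ≤ f.1}
  · exact hN.cond_frame_inter_tierEvent_covered wa .UAB i hτ hf .s
  · exact hN.cond_frame_mem_inter_tierEvent_covered wa .UAB i hτ {f | f.1 < i} .s
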